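/- Let $V$ be a Hausdorff smooth manifold of finite dimension, with a $C^1$ Lorentzian metric $g$ of signature $(+,-,\dots,-)$ and a time orientation (a continuous vector field that is timelike everywhere). A vector $v$ is causal if $g(v,v)\ge 0$; a nonzero causal vector is future-directed if it lies in the same half of the cone as the time orientation. A covariant 2-tensor $T$ at a point is *future* if $T(u,v)\ge 0$ for all future-directed $u,v$. A *causal symmetry* is a diffeomorphism of $V$ whose differential maps every future-directed vector to a future-directed vector. Let $\xi$ be a smooth complete vector field on $V$, with one-parameter group $\{\varphi_s\}_{s\in\mathbb R}$. A *local submonoid of causal symmetries* generated by $\xi$ is a family $\{\varphi_s\}_{s\in J,\ s\ge 0}$ of causal symmetries, where $J\subset\mathbb R$ is an interval that contains $0$ and some positive number; $\xi$ is *causal preserving* if it generates one. The *canonical null directions* of the submonoid are the nonzero null vectors $k$ such that $\varphi_s' k$ is null for all $s\in J$, $s\ge 0$. Put $$\mu_\xi=\{k\in TV:\ k\neq 0,\ g(k,k)=0,\ (\pounds_\xi g)(k,k)=0\}.$$ Suppose that there is a function $\alpha:V\to\mathbb R$ such that $\pounds_\xi g-\alpha g$ is future at every point and has the same algebraic (Segre)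 type at all points; that is, for any two points some bijection of the eigenvalues, compatible with complex conjugation, matches the Jordan blocks of the associated endomorphisms $T^a{}_b$ and matches the real eigenspaces that contain timelike vectors, respectively nonzero null vectors. 1. If $\mu_\xi=\varnothing$, then $\xi$ is causal preserving, and none of the local submonoids of causal symmetries that it generates has canonical null directions. 2. Suppose that $\mu_\xi\neq\varnothing$ and that there is a $p$-form $\Omega$ on $V$, differentiable along $\xi$, such that at each point $x$ it is the wedge product $k_1^\flat\wedge\dots\wedge k_p^\flat$, with $k_i^\flat=g(k_i,\cdot)$, for some maximal linearly independent set $\{k_1,\dots,k_p\}$ of elements of $\mu_\xi\cap T_xV$, and such that $\pounds_\xi\Omega=\beta\,\Omega$ for some function $\beta:V\to\mathbb R$. Then $\xi$ is causal preserving, and for every local submonoid of causal symmetries that it generates the set of canonical null directions is $\mu_\xi$. -/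

import Mathlib

open scoped Manifold ContDiff Bundle TensorProduct

noncomputable section

namespace CausalSym

variable {E : Type*} [NormedAddCommGroup E] [NormedSpace ℝ E]
  {V : Type*} [TopologicalSpace V] [ChartedSpace E V]

/-- A `C^1` Lorentzian metric of signature `(+,-,…,-)` on a manifold `V` modelled on `E`: a symmetric
`C^1` section of the bundle of bilinear forms such that every tangent space contains a vector of
positive length on whose orthogonal complement the form is negative definite. -/
structure LorentzMetric (E : Type*) [NormedAddCommGroup E] [NormedSpace ℝ E]
    (V : Type*) [TopologicalSpace V] [ChartedSpace E V] [IsManifold 𝓘(ℝ, E) ∞ V] where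
  form : ∀ x : V, TangentSpace 𝓘(ℝ, E) x →L[ℝ] TangentSpace 𝓘(ℝ, E) x →L[ℝ] ℝ
  contMDiff_form : ContMDiff 𝓘(ℝ, E) (𝓘(ℝ, E).prod 𝓘(ℝ, E →L[ℝ] E →L[ℝ] ℝ)) 1
    (fun x ↦ Bundle.TotalSpace.mk' (E →L[ℝ] E →L[ℝ] ℝ)
      (E := fun x : V ↦ TangentSpace 𝓘(ℝ, E) x →L[ℝ] TangentSpace 𝓘(ℝ, E) x →L[ℝ] ℝ) x (form x))
  symm : ∀ x u v, form x u v = form x v u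
  lorentzian : ∀ x, ∃ u, 0 < form x u u ∧ ∀ v, form x u v = 0 → v ≠ 0 → form x v v < 0

/-- A time orientation of `(V, g)`: a continuous vector field that is timelike everywhere. -/
structure TimeOrientation [IsManifold 𝓘(ℝ, E) ∞ V] (g : LorentzMetric E V) where
  field : ∀ x : V, TangentSpace 𝓘(ℝ, E) x
  continuous_field : Continuous (fun x ↦ (⟨x, field x⟩ : TangentBundle 𝓘(ℝ, E) V))
  timelike : ∀ x, 0 < g.form x (field x) (field x)

/-- `φ` is the one-parameter group generated by the vector field `ξ`: for every `x` the curve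
`s ↦ φ_s(x)` is an integral curve of `ξ`, defined on the whole real line, that starts at `x`. Such a
`φ` exists precisely when `ξ` is complete. -/
structure IsFlow (ξ : ∀ x : V, TangentSpace 𝓘(ℝ, E) x) (φ : ℝ → V → V) : Prop where
  map_zero : ∀ x, φ 0 x = x
  isMIntegralCurve : ∀ x, IsMIntegralCurve (I := 𝓘(ℝ, E)) (fun s ↦ φ s x) ξ

/-- The differential of a map `f : V → V` at `x`. -/
abbrev push (f : V → V) (x : V) :
    TangentSpace 𝓘(ℝ, E) x →L[ℝ] TangentSpace 𝓘(ℝ, E) (f x) :=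
  mfderiv 𝓘(ℝ, E) 𝓘(ℝ, E) f x

section Metric

variable [IsManifold 𝓘(ℝ, E) ∞ V]

/-- A causal vector `v` (that is, `g(v,v) ≥ 0`) which is future directed. -/
def IsFutureDirected (g : LorentzMetric E V) (τ : TimeOrientation g) (x : V)
    (v : TangentSpace 𝓘(ℝ, E) x) : Prop :=
  0 ≤ g.form x v v ∧ 0 < g.form x (τ.field x) v

/-- A rank-2 covariant tensor at `x` is future if it is nonnegative on future-directed vectors. -/
def IsFutureTensor (g : LorentzMetric E V) (τ : TimeOrientation g) (x : V)
    (T : TangentSpace 𝓘(ℝ, E) x → TangentSpace 𝓘(ℝ, E) x → ℝ) : Prop :=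
  ∀ u v, IsFutureDirected g τ x u → IsFutureDirected g τ x v → 0 ≤ T u v

/-- Causal symmetries: diffeomorphisms of `V` mapping future-directed vectors to future-directed
vectors. -/
def IsCausalSymmetry (g : LorentzMetric E V) (τ : TimeOrientation g) (f : V → V) : Prop :=
  (∃ Φ : V ≃ₘ^∞⟮𝓘(ℝ, E), 𝓘(ℝ, E)⟯ V, ⇑Φ = f) ∧
    ∀ x v, IsFutureDirected g τ x v → IsFutureDirected g τ (f x) (push f x v)

/-- `J` is an interval of the real line containing zero and some positive number, and
`φ_s` is a causal symmetry for every `s ∈ J` with `s ≥ 0`. -/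
def IsCausalSubmonoid (g : LorentzMetric E V) (τ : TimeOrientation g) (φ : ℝ → V → V)
    (J : Set ℝ) : Prop :=
  J.OrdConnected ∧ 0 ∈ J ∧ (∃ s ∈ J, 0 < s) ∧ ∀ s ∈ J, 0 ≤ s → IsCausalSymmetry g τ (φ s)

/-- The (complete) vector field `ξ` is causal preserving: it generates a local one-parameter
submonoid of causal symmetries. -/
def IsCausalPreserving (g : LorentzMetric E V) (τ : TimeOrientation g)
    (ξ : ∀ x : V, TangentSpace 𝓘(ℝ, E) x) : Prop :=
  ∃ φ, IsFlow ξ φ ∧ ∃ J, IsCausalSubmonoid g τ φ J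

/-- The canonical null directions of the submonoid `{φ_s : s ∈ J, s ≥ 0}`: the nonzero null vectors
that stay null under all its mappings. -/
def canonicalNullDirections (g : LorentzMetric E V) (φ : ℝ → V → V) (J : Set ℝ) :
    Set (TangentBundle 𝓘(ℝ, E) V) :=
  {k | k.2 ≠ 0 ∧ g.form k.1 k.2 k.2 = 0 ∧ ∀ s ∈ J, 0 ≤ s →
    g.form (φ s k.1) (push (φ s) k.1 k.2) (push (φ s) k.1 k.2) = 0}

/-- The Lie derivative of the metric along the vector field with flow `φ`: the derivative at `s = 0`
of the pulled back metric `φ_s^* g`. -/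
def lieMetric (g : LorentzMetric E V) (φ : ℝ → V → V) (x : V)
    (u v : TangentSpace 𝓘(ℝ, E) x) : ℝ :=
  deriv (fun s : ℝ ↦ g.form (φ s x) (push (φ s) x u) (push (φ s) x v)) 0

/-- The set `μ_ξ` of nonzero null vectors `k` with `(£_ξ g)(k,k) = 0`, where `φ` is the flow
of `ξ`. -/
def muSet (g : LorentzMetric E V) (φ : ℝ → V → V) : Set (TangentBundle 𝓘(ℝ, E) V) :=
  {k | k.2 ≠ 0 ∧ g.form k.1 k.2 k.2 = 0 ∧ lieMetric g φ k.1 k.2 k.2 = 0}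

/-- A `p`-form which at every point is the wedge product of (the metric duals of) a maximal
linearly independent family of elements of `μ_ξ`. The wedge product of one-forms `θ_1, …, θ_p` is
`(v_1, …, v_p) ↦ det (θ_i (v_j))`. -/
def IsWedgeOfMu (g : LorentzMetric E V) (φ : ℝ → V → V) {p : ℕ}
    (Ω : ∀ x : V, TangentSpace 𝓘(ℝ, E) x [⋀^Fin p]→L[ℝ] ℝ) : Prop :=
  ∀ x, ∃ k : Fin p → TangentSpace 𝓘(ℝ, E) x,
    (∀ i, (⟨x, k i⟩ : TangentBundle 𝓘(ℝ, E) V) ∈ muSet g φ) ∧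
    LinearIndependent ℝ k ∧
    (∀ v : TangentSpace 𝓘(ℝ, E) x, (⟨x, v⟩ : TangentBundle 𝓘(ℝ, E) V) ∈ muSet g φ →
      v ∈ Submodule.span ℝ (Set.range k)) ∧
    ∀ v : Fin p → TangentSpace 𝓘(ℝ, E) x,
      Ω x v = (Matrix.of fun i j ↦ g.form x (k i) (v j)).det

end Metric

/-- `£_ξ Ω ∝ Ω`: the `p`-form `Ω` has a Lie derivative along the vector field with flow `φ` (the
derivative of `φ_s^* Ω` at `s = 0`), and it is a multiple of `Ω` at every point. -/
def LieProportional (φ : ℝ → V → V) {p : ℕ}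
    (Ω : ∀ x : V, TangentSpace 𝓘(ℝ, E) x [⋀^Fin p]→L[ℝ] ℝ) : Prop :=
  ∃ β : V → ℝ, ∀ (x : V) (v : Fin p → TangentSpace 𝓘(ℝ, E) x),
    HasDerivAt (fun s : ℝ ↦ Ω (φ s x) (fun i ↦ push (φ s) x (v i))) (β x * Ω x v) 0

section AlgebraicType

variable [IsManifold 𝓘(ℝ, E) ∞ V]

/-- `A` is the endomorphism obtained from the rank-2 covariant tensor `T` by raising an index. -/
def IsRaised (g : LorentzMetric E V) (x : V)
    (T : TangentSpace 𝓘(ℝ, E) x → TangentSpace 𝓘(ℝ, E) x → ℝ)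
    (A : Module.End ℝ (TangentSpace 𝓘(ℝ, E) x)) : Prop :=
  ∀ u v, g.form x (A u) v = T u v

/-- The dimension of the kernel of `(A - z)^m` on the complexified tangent space. For all `z` and
`m` together these numbers are the sizes of the Jordan blocks of `A`. -/
def jordanDim {x : V} (A : Module.End ℝ (TangentSpace 𝓘(ℝ, E) x)) (z : ℂ) (m : ℕ) : ℕ :=
  Module.finrank ℂ (LinearMap.ker
    (((LinearMap.baseChange ℂ A : Module.End ℂ (ℂ ⊗[ℝ] TangentSpace 𝓘(ℝ, E) x)) -
      algebraMap ℂ (Module.End ℂ (ℂ ⊗[ℝ] TangentSpace 𝓘(ℝ, E) x)) z) ^ m))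

/-- Rank-2 covariant tensors `T` at `x` and `S` at `y` have the same algebraic (Segre) type: after a
relabelling `σ` of the eigenvalues that respects complex conjugation, their mixed versions have the
same Jordan blocks, and corresponding real eigenspaces agree as to whether they contain timelike
vectors and whether they contain null directions. -/
def SameAlgebraicType (g : LorentzMetric E V) (x y : V)
    (T : TangentSpace 𝓘(ℝ, E) x → TangentSpace 𝓘(ℝ, E) x → ℝ)
    (S : TangentSpace 𝓘(ℝ, E) y → TangentSpace 𝓘(ℝ, E) y → ℝ) : Prop :=
  ∃ A B, IsRaised g x T A ∧ IsRaised g y S B ∧ ∃ σ : ℂ ≃ ℂ,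
    (∀ z, σ (starRingEnd ℂ z) = starRingEnd ℂ (σ z)) ∧
    (∀ z m, jordanDim A z m = jordanDim B (σ z) m) ∧
    ∀ a b : ℝ, σ a = b →
      ((∃ v, 0 < g.form x v v ∧ A v = a • v) ↔ ∃ w, 0 < g.form y w w ∧ B w = b • w) ∧
      ((∃ v, v ≠ 0 ∧ g.form x v v = 0 ∧ A v = a • v) ↔
        ∃ w, w ≠ 0 ∧ g.form y w w = 0 ∧ B w = b • w)

end AlgebraicType

end CausalSym

end

/-!
Fix a point and pull the metric back along the flow: `B s = φ_s^* g` is a curve of Lorentzian forms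
on one tangent space, and the hypothesis says that `B' s` is nonnegative on the null cone of `B s`.

If `B s v v` is negative then, for any `t` timelike at time `s`, nonnegativity on the two null
vectors in the plane of `t` and `v` gives `(B v v / B t t)' ≥ 0`. Hence `B s v v` cannot become
negative: causal vectors stay causal, and by continuity future directed. Differentiating at time
zero shows that canonical null directions lie in `μ_ξ`.

Conversely, by the S-lemma `B' s - a • B s` is positive semidefinite for some `a`, and the vectors
of `μ_ξ` lie in its radical, so `B' s w = a • B s w` on their span `W s`. The equation
`£_ξ Ω = β Ω` says that the pulled back form keeps its direction, so the `B s`-orthogonal complement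
of `W s` is a constant subspace `N`. If `W s` is a null line, then it is contained in `N`, on which
`B s` is nonpositive, so a vector of `N` that is null at time zero stays null. Otherwise `W s`
contains a timelike vector, `N` is negative definite and `W s` is its orthogonal complement; the
`N`-component of a fixed vector of `W 0` has derivative zero, so `W s` is constant too, and along it
`B s` only changes by a positive factor.

The flow of a smooth field `f` is jointly smooth near time zero by the inverse function theorem,
applied to `(τ, γ) ↦ (τ, γ - τ ∫ f ∘ γ)` on a space of curves, and everywhere by the group law.
-/

namespace CausalSym

open Set Filter Topology

section Superposition

universe u

variable {K : Type*} [TopologicalSpace K] [CompactSpace K]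

/-- The pointwise application `(a, h) ↦ (t ↦ A (a t) (h t))` of a continuous bilinear map to two
curves, as a continuous bilinear map on the spaces of curves. -/
noncomputable def pointwiseBilin (K : Type*) [TopologicalSpace K] [CompactSpace K] {E F G : Type*}
    [NormedAddCommGroup E] [NormedSpace ℝ E] [NormedAddCommGroup F] [NormedSpace ℝ F]
    [NormedAddCommGroup G] [NormedSpace ℝ G] (A : G →L[ℝ] E →L[ℝ] F) :
    C(K, G) →L[ℝ] C(K, E) →L[ℝ] C(K, F) :=
  LinearMap.mkContinuous₂
    (LinearMap.mk₂ ℝ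
      (fun a h ↦ ⟨fun t ↦ A (a t) (h t), (A.continuous.comp a.continuous).clm_apply h.continuous⟩)
      (fun _ _ _ ↦ by ext; simp) (fun _ _ _ ↦ by ext; simp)
      (fun _ _ _ ↦ by ext; simp) (fun _ _ _ ↦ by ext; simp))
    ‖A‖ fun a h ↦ by
      rw [ContinuousMap.norm_le _ (by positivity)]
      exact fun t ↦ A.le_of_opNorm₂_le_of_le le_rfl (a.norm_coe_le_norm t) (h.norm_coe_le_norm t)

/-- The derivative of `f` is allowed to factor through `A`: for `G = E →L[ℝ] F` and `A = id` the
identification of topologies on `C(K, E →L[ℝ] F)` would otherwise defeat unification. -/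
theorem hasFDerivAt_postcomp {E F G : Type*} [NormedAddCommGroup E] [NormedSpace ℝ E]
    [NormedAddCommGroup F] [NormedSpace ℝ F] [NormedAddCommGroup G] [NormedSpace ℝ G]
    (A : G →L[ℝ] E →L[ℝ] F) (f : C(E, F)) (f' : C(E, G))
    (h : ∀ x, HasFDerivAt f (A (f' x)) x) (γ : C(K, E)) :
    HasFDerivAt f.comp (pointwiseBilin K A (f'.comp γ)) γ := by
  rw [hasFDerivAt_iff_isLittleO_nhds_zero, Asymptotics.isLittleO_iff]
  intro ε hε
  obtain ⟨δ, hδ, hf'δ⟩ := Metric.continuous_iff.1 (ContinuousMap.continuous_postcomp f') γ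
    (ε / (‖A‖ + 1)) (by positivity)
  filter_upwards [Metric.ball_mem_nhds (0 : C(K, E)) hδ] with η hη
  rw [mem_ball_zero_iff] at hη
  rw [ContinuousMap.norm_le _ (by positivity)]
  intro t
  have hbound : ∀ z ∈ segment ℝ (γ t) (γ t + η t), ‖A (f' z) - A (f' (γ t))‖ ≤ ε := by
    intro z hz
    obtain ⟨θ, ⟨hθ₀, hθ₁⟩, rfl⟩ : ∃ θ ∈ Icc (0 : ℝ) 1, γ t + θ • η t = z := by
      simpa [segment_eq_image'] using hz
    have hdist : dist (γ + θ • η) γ < δ := by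
      rw [dist_eq_norm, add_sub_cancel_left, norm_smul, Real.norm_of_nonneg hθ₀]
      exact (mul_le_of_le_one_left (norm_nonneg _) hθ₁).trans_lt hη
    have hnorm : ‖f' (γ t + θ • η t) - f' (γ t)‖ ≤ ε / (‖A‖ + 1) := by
      simpa [dist_eq_norm] using (ContinuousMap.dist_apply_le_dist t).trans (hf'δ _ hdist).le
    rw [← map_sub]
    calc _ ≤ ‖A‖ * (ε / (‖A‖ + 1)) := A.le_opNorm_of_le hnorm
      _ ≤ (‖A‖ + 1) * (ε / (‖A‖ + 1)) := by gcongr; linarith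
      _ = ε := by field_simp
  have hmean := Convex.norm_image_sub_le_of_norm_hasFDerivWithin_le'
    (fun x _ ↦ (h x).hasFDerivWithinAt) hbound (convex_segment _ _)
    (left_mem_segment _ _ _) (right_mem_segment _ _ _)
  rw [add_sub_cancel_left] at hmean
  exact hmean.trans (mul_le_mul_of_nonneg_left (η.norm_coe_le_norm t) hε.le)

variable {E : Type u} [NormedAddCommGroup E] [NormedSpace ℝ E]

theorem contDiff_nat_postcomp (n : ℕ) {F : Type u} [NormedAddCommGroup F] [NormedSpace ℝ F]
    (f : C(E, F)) (hf : ContDiff ℝ n f) : ContDiff ℝ n (f.comp : C(K, E) → C(K, F)) := by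
  induction n generalizing F with
  | zero => exact contDiff_zero.2 (ContinuousMap.continuous_postcomp f)
  | succ n ih =>
    push_cast at hf ⊢
    obtain ⟨f', hf', h⟩ := contDiff_succ_iff_hasFDerivAt.1 hf
    exact contDiff_succ_iff_hasFDerivAt.2 ⟨_,
      (pointwiseBilin K (ContinuousLinearMap.id ℝ (E →L[ℝ] F))).contDiff.comp
        (ih ⟨f', hf'.continuous⟩ hf'),
      hasFDerivAt_postcomp (ContinuousLinearMap.id ℝ (E →L[ℝ] F)) f ⟨f', hf'.continuous⟩ h⟩

theorem contDiff_postcomp {F : Type u} [NormedAddCommGroup F] [NormedSpace ℝ F]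
    (f : C(E, F)) (hf : ContDiff ℝ ∞ f) : ContDiff ℝ ∞ (f.comp : C(K, E) → C(K, F)) :=
  contDiff_infty.2 fun n ↦ contDiff_nat_postcomp n f (contDiff_infty.1 hf n)

end Superposition

section LocalFlow

variable {E : Type*} [NormedAddCommGroup E] [NormedSpace ℝ E] [CompleteSpace E]

/-- The primitive `t ↦ ∫₀ᵗ u` of a continuous curve on `[-2, 2]`. -/
noncomputable def primitive (E : Type*) [NormedAddCommGroup E] [NormedSpace ℝ E] [CompleteSpace E] :
    C(Icc (-2 : ℝ) 2, E) →L[ℝ] C(Icc (-2 : ℝ) 2, E) :=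
  have hext (u : C(Icc (-2 : ℝ) 2, E)) : Continuous (IccExtend (by norm_num) u) :=
    u.continuous.Icc_extend'
  LinearMap.mkContinuous
    { toFun := fun u ↦ ⟨fun t ↦ ∫ r in (0 : ℝ)..t, IccExtend (by norm_num) u r,
        (intervalIntegral.continuous_primitive
          (fun a b ↦ (hext u).intervalIntegrable a b) 0).comp continuous_subtype_val⟩
      map_add' := fun u v ↦ by
        ext t
        exact intervalIntegral.integral_add ((hext u).intervalIntegrable _ _)
          ((hext v).intervalIntegrable _ _)
      map_smul' := fun c u ↦ by
        ext t
        exact intervalIntegral.integral_smul c _ }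
    2 fun u ↦ by
      rw [ContinuousMap.norm_le _ (by positivity)]
      intro t
      refine (intervalIntegral.norm_integral_le_of_norm_le_const (C := ‖u‖)
        fun r _ ↦ u.norm_coe_le_norm _).trans ?_
      rw [sub_zero, mul_comm]
      exact mul_le_mul_of_nonneg_right (abs_le.2 t.2) (norm_nonneg _)

/-- The map `(τ, γ) ↦ (τ, γ - τ ∫₀ f(γ))`. A curve `γ` with `picardMap f (τ, γ) = (τ, const x)` is
an integral curve of `τ f` that starts at `x`. -/
noncomputable def picardMap (f : C(E, E)) (p : ℝ × C(Icc (-2 : ℝ) 2, E)) :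
    ℝ × C(Icc (-2 : ℝ) 2, E) :=
  (p.1, p.2 - p.1 • primitive E (f.comp p.2))

theorem contDiff_primitive_comp {f : C(E, E)} (hf : ContDiff ℝ ∞ f) :
    ContDiff ℝ ∞ fun γ ↦ primitive E (f.comp γ) :=
  (primitive E).contDiff.comp (contDiff_postcomp f hf)

theorem contDiff_picardMap {f : C(E, E)} (hf : ContDiff ℝ ∞ f) : ContDiff ℝ ∞ (picardMap f) :=
  contDiff_fst.prodMk (contDiff_snd.sub
    (contDiff_fst.smul ((contDiff_primitive_comp hf).comp contDiff_snd)))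

theorem hasFDerivAt_picardMap_zero {f : C(E, E)} (hf : ContDiff ℝ ∞ f)
    (γ : C(Icc (-2 : ℝ) 2, E)) :
    HasFDerivAt (picardMap f) ((ContinuousLinearEquiv.refl ℝ ℝ).skewProd
      (ContinuousLinearEquiv.refl ℝ C(Icc (-2 : ℝ) 2, E))
      (-ContinuousLinearMap.toSpanSingleton ℝ (primitive E (f.comp γ))) :
        (ℝ × C(Icc (-2 : ℝ) 2, E)) →L[ℝ] ℝ × C(Icc (-2 : ℝ) 2, E)) (0, γ) := by
  have hprim := (((contDiff_primitive_comp hf).comp contDiff_snd).differentiable (by simp)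
    ((0 : ℝ), γ)).hasFDerivAt
  refine (hasFDerivAt_fst.prodMk
    (hasFDerivAt_snd.sub (hasFDerivAt_fst.smul hprim))).congr_fderiv ?_
  ext p <;> simp [ContinuousLinearEquiv.skewProd_apply]

/-- Inverse function theorem for `picardMap f` at `(0, const x₀)`. -/
theorem exists_contDiffAt_picardMap_eq {f : C(E, E)} (hf : ContDiff ℝ ∞ f) (x₀ : E) :
    ∃ Γ : ℝ × E → C(Icc (-2 : ℝ) 2, E), ContDiffAt ℝ ∞ Γ (0, x₀) ∧ Γ (0, x₀) = .const _ x₀ ∧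
      ∀ᶠ q in 𝓝 (0, x₀), picardMap f (q.1, Γ q) = (q.1, .const _ q.2) := by
  have hfix : picardMap f (0, .const _ x₀) = (0, .const _ x₀) := by simp [picardMap]
  have hder := hasFDerivAt_picardMap_zero hf (.const _ x₀)
  have hsmooth := (contDiff_picardMap hf).contDiffAt (x := (0, .const _ x₀))
  have hstrict := hsmooth.hasStrictFDerivAt' hder (by simp)
  let c : ℝ × E →L[ℝ] ℝ × C(Icc (-2 : ℝ) 2, E) :=
    (ContinuousLinearMap.id ℝ ℝ).prodMap (ContinuousLinearMap.const ℝ _)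
  set inv := hsmooth.localInverse hder (by simp)
  have hinv : ContDiffAt ℝ ∞ inv _ := hsmooth.to_localInverse hder (by simp)
  have hinv_fix : inv _ = _ := hstrict.localInverse_apply_image
  have hright : ∀ᶠ y in 𝓝 _, picardMap f (inv y) = y := hstrict.eventually_right_inverse
  rw [hfix] at hinv hinv_fix hright
  refine ⟨fun q ↦ (inv (c q)).2,
    contDiffAt_snd.comp _ (ContDiffAt.comp (0, x₀) hinv c.contDiff.contDiffAt),
    congrArg Prod.snd hinv_fix, ?_⟩
  filter_upwards [c.continuous.continuousAt.eventually hright] with q hq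
  have hfst : (inv (c q)).1 = q.1 := congrArg Prod.fst hq
  calc picardMap f (q.1, (inv (c q)).2) = picardMap f (inv (c q)) := by rw [← hfst]
    _ = c q := hq

theorem IccExtend_eq_of_picardMap_eq {f : C(E, E)} {τ : ℝ} {γ : C(Icc (-2 : ℝ) 2, E)} {x : E}
    (h : picardMap f (τ, γ) = (τ, .const _ x)) {t : ℝ} (ht : t ∈ Icc (-2 : ℝ) 2) :
    IccExtend (by norm_num : (-2 : ℝ) ≤ 2) γ t =
      x + τ • ∫ r in (0 : ℝ)..t, f (IccExtend (by norm_num : (-2 : ℝ) ≤ 2) γ r) := by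
  rw [IccExtend_of_mem _ γ ht]
  exact sub_eq_iff_eq_add.1 (congrArg (fun p ↦ p.2 ⟨t, ht⟩) h)

theorem hasDerivAt_of_picardMap_eq {f : C(E, E)} {τ : ℝ} {γ : C(Icc (-2 : ℝ) 2, E)} {x : E}
    (h : picardMap f (τ, γ) = (τ, .const _ x)) {t : ℝ} (ht : t ∈ Ioo (-2 : ℝ) 2) :
    HasDerivAt (IccExtend (by norm_num : (-2 : ℝ) ≤ 2) γ)
      (τ • f (IccExtend (by norm_num : (-2 : ℝ) ≤ 2) γ t)) t := by
  have hcont : Continuous fun r ↦ f (IccExtend (by norm_num : (-2 : ℝ) ≤ 2) γ r) :=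
    f.continuous.comp γ.continuous.Icc_extend'
  refine (((hcont.integral_hasStrictDerivAt 0 t).hasDerivAt.const_smul τ).const_add
    x).congr_of_eventuallyEq ?_
  filter_upwards [Icc_mem_nhds ht.1 ht.2] with r hr
  exact IccExtend_eq_of_picardMap_eq h hr

/-- Since `τ` scales the field, the value at time `1` of the integral curve of `τ • f` through `x`
is the local flow of `f` at time `τ`. -/
theorem exists_contDiffAt_localFlow {f : E → E} (hf : ContDiff ℝ ∞ f) (x₀ : E) {U : Set E}
    (hU : U ∈ 𝓝 x₀) :
    ∃ ψ : ℝ × E → E, ContDiffAt ℝ ∞ ψ (0, x₀) ∧ ∀ᶠ q in 𝓝 ((0 : ℝ), x₀), ∃ γ : ℝ → E,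
      γ 0 = q.2 ∧ γ 1 = ψ q ∧ ∀ t ∈ Ioo (-2 : ℝ) 2, γ t ∈ U ∧ HasDerivAt γ (q.1 • f (γ t)) t := by
  obtain ⟨Γ, hΓ, hΓ₀, hpicard⟩ := exists_contDiffAt_picardMap_eq (f := ⟨f, hf.continuous⟩) hf x₀
  obtain ⟨r, hr, hrU⟩ := Metric.mem_nhds_iff.1 hU
  have hmem₀ : (0 : ℝ) ∈ Icc (-2) 2 := by constructor <;> norm_num
  have hmem₁ : (1 : ℝ) ∈ Icc (-2) 2 := by constructor <;> norm_num
  have hnear : ∀ᶠ q in 𝓝 ((0 : ℝ), x₀), dist (Γ q) (.const _ x₀) < r :=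
    hΓ.continuousAt.eventually (by rw [hΓ₀]; exact Metric.ball_mem_nhds _ hr)
  let ev : C(Icc (-2 : ℝ) 2, E) →L[ℝ] E := ContinuousMap.evalCLM ℝ ⟨1, hmem₁⟩
  refine ⟨fun q ↦ ev (Γ q), ev.contDiff.contDiffAt.comp _ hΓ, ?_⟩
  filter_upwards [hnear, hpicard] with q hq hq'
  refine ⟨IccExtend (by norm_num) (Γ q), ?_, IccExtend_of_mem _ _ hmem₁, fun t ht ↦
    ⟨hrU ?_, hasDerivAt_of_picardMap_eq hq' ht⟩⟩
  · simp [IccExtend_eq_of_picardMap_eq hq' hmem₀]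
  · rw [IccExtend_of_mem _ _ (Ioo_subset_Icc_self ht)]
    exact (ContinuousMap.dist_apply_le_dist (g := .const _ x₀) _).trans_lt hq

end LocalFlow

section Flow

variable {E : Type*} [NormedAddCommGroup E] [NormedSpace ℝ E]
  {V : Type*} [TopologicalSpace V] [ChartedSpace E V] [IsManifold 𝓘(ℝ, E) ∞ V]
  {ξ : ∀ x : V, TangentSpace 𝓘(ℝ, E) x} {φ : ℝ → V → V}

/-- `φ` is the one-parameter group generated by the smooth complete vector field `ξ`. -/
structure IsSmoothFlow (ξ : ∀ x : V, TangentSpace 𝓘(ℝ, E) x) (φ : ℝ → V → V) : Prop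
    extends IsFlow ξ φ where
  contMDiff_field : ContMDiff 𝓘(ℝ, E) 𝓘(ℝ, E).tangent ∞
    (fun x ↦ (⟨x, ξ x⟩ : TangentBundle 𝓘(ℝ, E) V))

/-- The representative of a vector field in the chart at `x₀`. -/
noncomputable def chartField (ξ : ∀ x : V, TangentSpace 𝓘(ℝ, E) x) (x₀ : V) (y : E) : E :=
  tangentCoordChange 𝓘(ℝ, E) ((extChartAt 𝓘(ℝ, E) x₀).symm y) x₀
    ((extChartAt 𝓘(ℝ, E) x₀).symm y) (ξ ((extChartAt 𝓘(ℝ, E) x₀).symm y))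

theorem contDiffOn_chartField
    (hξ : ContMDiff 𝓘(ℝ, E) 𝓘(ℝ, E).tangent ∞
      (fun x ↦ (⟨x, ξ x⟩ : TangentBundle 𝓘(ℝ, E) V))) (x₀ : V) :
    ContDiffOn ℝ ∞ (chartField ξ x₀) (extChartAt 𝓘(ℝ, E) x₀).target := by
  refine (contDiff_snd.comp_contDiffOn ((contMDiff_iff.1 hξ).2 x₀ ⟨x₀, ξ x₀⟩)).mono
    fun y hy ↦ ⟨hy, ?_⟩
  simpa [mfld_simps] using (extChartAt 𝓘(ℝ, E) x₀).map_target hy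

theorem hasMFDerivAt_extChartAt_symm_comp {x₀ : V} {γ : ℝ → E} {t : ℝ}
    (hmem : γ t ∈ (extChartAt 𝓘(ℝ, E) x₀).target)
    (h : HasDerivAt γ (chartField ξ x₀ (γ t)) t) :
    HasMFDerivAt 𝓘(ℝ, ℝ) 𝓘(ℝ, E) ((extChartAt 𝓘(ℝ, E) x₀).symm ∘ γ) t
      ((1 : ℝ →L[ℝ] ℝ).smulRight (ξ (((extChartAt 𝓘(ℝ, E) x₀).symm ∘ γ) t))) := by
  have : IsManifold 𝓘(ℝ, E) 1 V := IsManifold.of_le (n := ∞) (by simp)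
  let xₜ : V := (extChartAt 𝓘(ℝ, E) x₀).symm (γ t)
  have hx₀ : xₜ ∈ (extChartAt 𝓘(ℝ, E) x₀).source := (extChartAt 𝓘(ℝ, E) x₀).map_target hmem
  have hxₜ : xₜ ∈ (extChartAt 𝓘(ℝ, E) xₜ).source := mem_extChartAt_source xₜ
  suffices hd : HasDerivAt ((extChartAt 𝓘(ℝ, E) xₜ ∘ (extChartAt 𝓘(ℝ, E) x₀).symm) ∘ γ)
      (ξ xₜ) t from
    ⟨(continuousAt_extChartAt_symm'' hmem).comp h.continuousAt,
      hd.hasDerivWithinAt.hasFDerivWithinAt⟩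
  have hξt : tangentCoordChange 𝓘(ℝ, E) x₀ xₜ xₜ (chartField ξ x₀ (γ t)) = ξ xₜ :=
    (tangentCoordChange_comp (x := x₀) ⟨⟨hxₜ, hx₀⟩, hxₜ⟩).trans (tangentCoordChange_self hxₜ)
  have hchange : HasFDerivAt (extChartAt 𝓘(ℝ, E) xₜ ∘ (extChartAt 𝓘(ℝ, E) x₀).symm)
      (tangentCoordChange 𝓘(ℝ, E) x₀ xₜ xₜ) (γ t) := by
    apply HasFDerivWithinAt.hasFDerivAt (s := range 𝓘(ℝ, E)) _ (by simp)
    rw [← (extChartAt 𝓘(ℝ, E) x₀).right_inv hmem]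
    exact hasFDerivWithinAt_tangentCoordChange ⟨hx₀, hxₜ⟩
  exact hξt ▸ hchange.comp_hasDerivAt t h

theorem exists_contDiff_eqOn_chartField [FiniteDimensional ℝ E]
    (hξ : ContMDiff 𝓘(ℝ, E) 𝓘(ℝ, E).tangent ∞
      (fun x ↦ (⟨x, ξ x⟩ : TangentBundle 𝓘(ℝ, E) V))) (x₀ : V) :
    ∃ f : E → E, ContDiff ℝ ∞ f ∧ ∃ U ∈ 𝓝 (extChartAt 𝓘(ℝ, E) x₀ x₀),
      U ⊆ (extChartAt 𝓘(ℝ, E) x₀).target ∧ EqOn f (chartField ξ x₀) U := by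
  have hopen : IsOpen (extChartAt 𝓘(ℝ, E) x₀).target := isOpen_extChartAt_target x₀
  obtain ⟨r, hr, hsub⟩ := Metric.nhds_basis_closedBall.mem_iff.1
    (hopen.mem_nhds (mem_extChartAt_target (I := 𝓘(ℝ, E)) x₀))
  let χ : ContDiffBump (extChartAt 𝓘(ℝ, E) x₀ x₀) := ⟨r / 2, r, by positivity, by linarith⟩
  have hχ : tsupport χ ⊆ (extChartAt 𝓘(ℝ, E) x₀).target := χ.tsupport_eq ▸ hsub
  refine ⟨fun y ↦ χ y • chartField ξ x₀ y, ?_, Metric.closedBall _ (r / 2),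
    Metric.closedBall_mem_nhds _ (by positivity),
    (Metric.closedBall_subset_closedBall (by linarith)).trans hsub, fun y hy ↦ ?_⟩
  · rw [← contMDiff_iff_contDiff]
    refine contMDiff_of_tsupport fun y hy ↦ ContDiffAt.contMDiffAt ?_
    have hy' := hχ (tsupport_smul_subset_left _ _ hy)
    exact χ.contDiffAt.smul ((contDiffOn_chartField hξ x₀).contDiffAt (hopen.mem_nhds hy'))
  · simp only [χ.one_of_mem_closedBall hy, one_smul]

namespace IsSmoothFlow

variable [T2Space V]

theorem map_add (hφ : IsSmoothFlow ξ φ) (s t : ℝ) (x : V) : φ (s + t) x = φ s (φ t x) := by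
  have : IsManifold 𝓘(ℝ, E) 1 V := IsManifold.of_le (n := ∞) (by simp)
  exact congrFun (isMIntegralCurve_Ioo_eq_of_contMDiff_boundaryless (t₀ := 0)
    (hφ.contMDiff_field.of_le (by simp)) ((hφ.isMIntegralCurve x).comp_add t)
    (hφ.isMIntegralCurve (φ t x)) (by simp [hφ.map_zero])) s

theorem eq_extChartAt_symm_of_hasDerivAt (hφ : IsSmoothFlow ξ φ) {x₀ x : V} {τ : ℝ} {γ : ℝ → E}
    (hx : x ∈ (extChartAt 𝓘(ℝ, E) x₀).source) (hγ₀ : γ 0 = extChartAt 𝓘(ℝ, E) x₀ x)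
    (hmem : ∀ t ∈ Ioo (-2 : ℝ) 2, γ t ∈ (extChartAt 𝓘(ℝ, E) x₀).target)
    (hγ : ∀ t ∈ Ioo (-2 : ℝ) 2, HasDerivAt γ (τ • chartField ξ x₀ (γ t)) t) :
    φ τ x = (extChartAt 𝓘(ℝ, E) x₀).symm (γ 1) := by
  have : IsManifold 𝓘(ℝ, E) 1 V := IsManifold.of_le (n := ∞) (by simp)
  have hchart : IsMIntegralCurveOn (I := 𝓘(ℝ, E))
      (fun t ↦ (extChartAt 𝓘(ℝ, E) x₀).symm (γ t)) (τ • ξ) (Ioo (-2) 2) := by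
    intro t ht
    refine (hasMFDerivAt_extChartAt_symm_comp (ξ := τ • ξ) (hmem t ht) ?_).hasMFDerivWithinAt
    convert hγ t ht using 1
    exact map_smul _ _ _
  have hflow : IsMIntegralCurveOn (I := 𝓘(ℝ, E)) ((fun s ↦ φ s x) ∘ (· * τ)) (τ • ξ)
      (Ioo (-2) 2) := ((hφ.isMIntegralCurve x).comp_mul τ).isMIntegralCurveOn _
  have hfield : ContMDiff 𝓘(ℝ, E) 𝓘(ℝ, E).tangent 1
      (fun x ↦ (⟨x, (τ • ξ) x⟩ : TangentBundle 𝓘(ℝ, E) V)) :=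
    (hφ.contMDiff_field.of_le (by simp)).const_smul_section
  have hmem₀ : (0 : ℝ) ∈ Ioo (-2) 2 := by constructor <;> norm_num
  have hmem₁ : (1 : ℝ) ∈ Ioo (-2) 2 := by constructor <;> norm_num
  have heq := isMIntegralCurveOn_Ioo_eqOn_of_contMDiff_boundaryless hmem₀ hfield hflow hchart
    (by simpa [hγ₀, hφ.map_zero] using ((extChartAt 𝓘(ℝ, E) x₀).left_inv hx).symm) hmem₁
  simpa using heq

theorem contMDiffAt_uncurry_of_sub (hφ : IsSmoothFlow ξ φ) {m : ℕ} {s s' : ℝ} {x : V}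
    (hs' : ContMDiffAt (𝓘(ℝ, ℝ).prod 𝓘(ℝ, E)) 𝓘(ℝ, E) m (Function.uncurry φ) (s', x))
    (hsub : ContMDiffAt (𝓘(ℝ, ℝ).prod 𝓘(ℝ, E)) 𝓘(ℝ, E) m (Function.uncurry φ)
      (s - s', φ s' x)) :
    ContMDiffAt (𝓘(ℝ, ℝ).prod 𝓘(ℝ, E)) 𝓘(ℝ, E) m (Function.uncurry φ) (s, x) := by
  have hgroup : Function.uncurry φ = Function.uncurry φ ∘
      fun q : ℝ × V ↦ (q.1 - s', Function.uncurry φ (s', q.2)) := by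
    funext q
    simp [Function.uncurry, ← hφ.map_add]
  have htime : ContMDiffAt (𝓘(ℝ, ℝ).prod 𝓘(ℝ, E)) 𝓘(ℝ, ℝ) m
      (fun q : ℝ × V ↦ q.1 - s') (s, x) := contMDiffAt_fst.sub contMDiffAt_const
  have hspace : ContMDiffAt (𝓘(ℝ, ℝ).prod 𝓘(ℝ, E)) 𝓘(ℝ, E) m
      (fun q : ℝ × V ↦ Function.uncurry φ (s', q.2)) (s, x) :=
    ContMDiffAt.comp (I' := 𝓘(ℝ, ℝ).prod 𝓘(ℝ, E)) (s, x) hs'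
      (contMDiffAt_const.prodMk contMDiffAt_snd)
  rw [hgroup]
  exact ContMDiffAt.comp (I' := 𝓘(ℝ, ℝ).prod 𝓘(ℝ, E)) (s, x) hsub (htime.prodMk hspace)

variable [FiniteDimensional ℝ E]

theorem contMDiffAt_uncurry_zero (hφ : IsSmoothFlow ξ φ) (x₀ : V) :
    ContMDiffAt (𝓘(ℝ, ℝ).prod 𝓘(ℝ, E)) 𝓘(ℝ, E) ∞ (Function.uncurry φ) (0, x₀) := by
  have : CompleteSpace E := FiniteDimensional.complete ℝ E
  obtain ⟨f, hf, U, hU, hUt, hfU⟩ := exists_contDiff_eqOn_chartField hφ.contMDiff_field x₀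
  obtain ⟨ψ, hψ, hcurve⟩ := exists_contDiffAt_localFlow hf _ hU
  set e := extChartAt 𝓘(ℝ, E) x₀
  have hcoord : ContMDiffAt (𝓘(ℝ, ℝ).prod 𝓘(ℝ, E)) 𝓘(ℝ, ℝ × E) ∞
      (fun q : ℝ × V ↦ (q.1, e q.2)) (0, x₀) :=
    contMDiffAt_fst.prodMk_space
      ((contMDiffAt_extChartAt (x := x₀)).comp ((0 : ℝ), x₀) contMDiffAt_snd)
  have hψ_mem : ψ (0, e x₀) ∈ e.target := by
    obtain ⟨γ, -, hγ₁, hγ⟩ := hcurve.self_of_nhds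
    exact hγ₁ ▸ hUt (hγ 1 (by constructor <;> norm_num)).1
  have hsymm : ContMDiffAt 𝓘(ℝ, E) 𝓘(ℝ, E) ∞ e.symm (ψ (0, e x₀)) :=
    (contMDiffOn_extChartAt_symm x₀).contMDiffAt
      ((isOpen_extChartAt_target (I := 𝓘(ℝ, E)) x₀).mem_nhds hψ_mem)
  have hlocal : ContMDiffAt (𝓘(ℝ, ℝ).prod 𝓘(ℝ, E)) 𝓘(ℝ, E) ∞
      (fun q : ℝ × V ↦ e.symm (ψ (q.1, e q.2))) (0, x₀) :=
    ContMDiffAt.comp (g := e.symm) (0, x₀) hsymm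
      (ContMDiffAt.comp (g := ψ) (0, x₀) hψ.contMDiffAt hcoord)
  refine hlocal.congr_of_eventuallyEq ?_
  have hsource : ∀ᶠ q : ℝ × V in 𝓝 (0, x₀), q.2 ∈ e.source :=
    continuous_snd.continuousAt.eventually (extChartAt_source_mem_nhds (I := 𝓘(ℝ, E)) x₀)
  filter_upwards [hsource, hcoord.continuousAt.eventually hcurve] with q hq ⟨γ, hγ₀, hγ₁, hγ⟩
  rw [← hγ₁]
  exact hφ.eq_extChartAt_symm_of_hasDerivAt hq hγ₀ (fun t ht ↦ hUt (hγ t ht).1)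
    fun t ht ↦ hfU (hγ t ht).1 ▸ (hγ t ht).2

/-- For finite `m` the times at which `φ` is `C^m` near `(s, x)` form a clopen set, because
`φ_s = φ_{s - s'} ∘ φ_{s'}` and `φ` is smooth at time zero. -/
theorem contMDiffAt_uncurry_nat (hφ : IsSmoothFlow ξ φ) (m : ℕ) (s : ℝ) (x : V) :
    ContMDiffAt (𝓘(ℝ, ℝ).prod 𝓘(ℝ, E)) 𝓘(ℝ, E) m (Function.uncurry φ) (s, x) := by
  have : IsManifold 𝓘(ℝ, E) m V := IsManifold.of_le (n := ∞) (by exact_mod_cast le_top)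
  have hzero (y : V) : ∀ᶠ q in 𝓝 ((0 : ℝ), y),
      ContMDiffAt (𝓘(ℝ, ℝ).prod 𝓘(ℝ, E)) 𝓘(ℝ, E) m (Function.uncurry φ) q :=
    (contMDiffAt_iff_contMDiffAt_nhds (by simp)).1
      (contMDiffAt_infty.1 (hφ.contMDiffAt_uncurry_zero y) m)
  let A : Set ℝ := {s | ContMDiffAt (𝓘(ℝ, ℝ).prod 𝓘(ℝ, E)) 𝓘(ℝ, E) m (Function.uncurry φ) (s, x)}
  have hopen : IsOpen A := isOpen_iff_mem_nhds.2 fun s₁ hs₁ ↦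
    (Continuous.prodMk_left x).continuousAt.eventually
      ((contMDiffAt_iff_contMDiffAt_nhds (by simp)).1 hs₁)
  have hclosed : IsClosed A := by
    refine isClosed_of_closure_subset fun s₁ hs₁ ↦ ?_
    have hcont : ContinuousAt (fun s' ↦ (s₁ - s', φ s' x)) s₁ :=
      (continuous_const.sub continuous_id).continuousAt.prodMk
        (hφ.isMIntegralCurve x).continuous.continuousAt
    have hnear := hcont.eventually (by simpa using hzero (φ s₁ x))
    obtain ⟨s', hs', hs'A⟩ := mem_closure_iff_nhds.1 hs₁ _ hnear
    exact hφ.contMDiffAt_uncurry_of_sub hs'A hs'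
  have hA₀ : (0 : ℝ) ∈ A := (hzero x).self_of_nhds
  exact (IsClopen.eq_univ ⟨hclosed, hopen⟩ ⟨0, hA₀⟩).ge (mem_univ s)

theorem contMDiff_uncurry (hφ : IsSmoothFlow ξ φ) :
    ContMDiff (𝓘(ℝ, ℝ).prod 𝓘(ℝ, E)) 𝓘(ℝ, E) ∞ (Function.uncurry φ) :=
  fun q ↦ contMDiffAt_infty.2 fun m ↦ hφ.contMDiffAt_uncurry_nat m q.1 q.2

theorem contMDiff_time (hφ : IsSmoothFlow ξ φ) (s : ℝ) :
    ContMDiff 𝓘(ℝ, E) 𝓘(ℝ, E) ∞ (φ s) :=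
  hφ.contMDiff_uncurry.comp (contMDiff_const.prodMk contMDiff_id)

end IsSmoothFlow

end Flow

section LorentzForm

variable {M : Type*} [AddCommGroup M] [Module ℝ M] {b D : LinearMap.BilinForm ℝ M}

/-- Symmetric bilinear forms of signature `(+,-,…,-)`, encoded as in `LorentzMetric`: some vector of
positive length has a negative definite orthogonal complement. -/
structure IsLorentzForm (b : LinearMap.BilinForm ℝ M) : Prop extends b.IsSymm where
  exists_timelike : ∃ u, 0 < b u u ∧ ∀ v, b u v = 0 → v ≠ 0 → b v v < 0

theorem IsLorentzForm.neg_of_orthogonal (hb : IsLorentzForm b) {t v : M} (ht : 0 < b t t)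
    (htv : b t v = 0) (hv : v ≠ 0) : b v v < 0 := by
  obtain ⟨u, -, hneg⟩ := hb.exists_timelike
  have hut : b u t ≠ 0 := fun h ↦
    lt_asymm ht (hneg t h fun h0 ↦ by simp [h0] at ht)
  by_contra! hvv
  set z := b u v • t - b u t • v with hz
  have huz : b u z = 0 := by
    simp only [hz, map_sub, map_smul, smul_eq_mul]
    ring
  have hzz : b z z = (b u v) ^ 2 * b t t + (b u t) ^ 2 * b v v := by
    simp only [hz, map_sub, map_smul, LinearMap.sub_apply, LinearMap.smul_apply, smul_eq_mul, htv,
      hb.eq v t]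
    ring
  have hz0 : z = 0 := by
    by_contra h
    exact absurd (hneg z huz h) (not_lt.2 (by rw [hzz]; positivity))
  have htz : b u v * b t t = 0 := by simpa [hz, htv] using congrArg (b t) hz0
  exact absurd (hneg v ((mul_eq_zero.1 htz).resolve_right ht.ne') hv) (not_lt.2 hvv)

theorem IsLorentzForm.apply_ne_zero_of_causal (hb : IsLorentzForm b) {t v : M} (ht : 0 < b t t)
    (hv : 0 ≤ b v v) (hv0 : v ≠ 0) : b t v ≠ 0 :=
  fun h ↦ absurd (hb.neg_of_orthogonal ht h hv0) (not_lt.2 hv)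

theorem IsLorentzForm.nonpos_of_orthogonal_null (hb : IsLorentzForm b) {k v : M} (hk0 : k ≠ 0)
    (hk : b k k = 0) (hkv : b k v = 0) : b v v ≤ 0 := by
  by_contra! h
  exact hb.apply_ne_zero_of_causal h hk.ge hk0 (by rw [hb.eq, hkv])

theorem IsLorentzForm.ker_eq_bot (hb : IsLorentzForm b) : LinearMap.ker b = ⊥ := by
  refine (Submodule.eq_bot_iff _).2 fun v (hv : b v = 0) ↦ ?_
  obtain ⟨t, ht, -⟩ := hb.exists_timelike
  by_contra hv0
  exact (hb.neg_of_orthogonal ht (by rw [hb.eq, hv, LinearMap.zero_apply]) hv0).ne (by simp [hv])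

theorem IsLorentzForm.exists_spacelike (hb : IsLorentzForm b) {k : M} (hk0 : k ≠ 0)
    (hk : b k k = 0) : ∃ w, b w w < 0 := by
  obtain ⟨t, ht, hneg⟩ := hb.exists_timelike
  refine ⟨b t t • k - b t k • t, hneg _ (by simp [mul_comm]) fun h ↦ ?_⟩
  have htk : b t k ≠ 0 := hb.apply_ne_zero_of_causal ht hk.ge hk0
  have hself : b t k * b k t = 0 := by simpa [hk] using congrArg (b k) h
  simp [hb.eq k t, htk] at hself

theorem IsLorentzForm.comp_of_bijective (hb : IsLorentzForm b) {M' : Type*} [AddCommGroup M']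
    [Module ℝ M'] {f : M' →ₗ[ℝ] M} (hf : Function.Bijective f) : IsLorentzForm (b.comp f f) where
  eq u v := hb.eq (f u) (f v)
  exists_timelike := by
    obtain ⟨t, ht, hneg⟩ := hb.exists_timelike
    obtain ⟨u, rfl⟩ := hf.2 t
    exact ⟨u, ht, fun v huv hv ↦ hneg (f v) huv ((map_ne_zero_iff f hf.1).2 hv)⟩

theorem IsLorentzForm.exists_timelike_add_smul (hb : IsLorentzForm b) {k l : M}
    (hkl : LinearIndependent ℝ ![k, l]) (hk : b k k = 0) (hl : b l l = 0) :
    ∃ c : ℝ, 0 < b (k + c • l) (k + c • l) := by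
  obtain ⟨t, ht, hneg⟩ := hb.exists_timelike
  have hl0 : l ≠ 0 := by simpa using hkl.ne_zero 1
  have hbkl : b k l ≠ 0 := by
    intro h
    have hz : b t l • k - b t k • l = 0 := by
      by_contra hz
      have := hneg _ (by simp [mul_comm]) hz
      simp [hk, hl, h, hb.eq l k] at this
    have htl : b t l = 0 := (LinearIndependent.pair_iff.1 hkl _ (-b t k)
      (by rw [neg_smul, ← sub_eq_add_neg, hz])).1
    exact hb.apply_ne_zero_of_causal ht hl.ge hl0 htl
  refine ⟨b k l, ?_⟩
  have : b (k + b k l • l) (k + b k l • l) = 2 * (b k l) ^ 2 := by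
    simp only [map_add, map_smul, LinearMap.add_apply, LinearMap.smul_apply, smul_eq_mul, hk, hl,
      hb.eq l k]
    ring
  rw [this]
  positivity

/-- The two null vectors in the plane of `t` and `w` are `t + x • w` and `t + y • w`, where
`x * y = b t t / b w w < 0`; eliminating the mixed term `D t w` between them gives the claim. -/
theorem mul_le_mul_of_nonneg_on_null (hb : b.IsSymm) (hD : D.IsSymm)
    (hnull : ∀ k, b k k = 0 → 0 ≤ D k k) {t w : M} (ht : 0 < b t t) (hw : b w w < 0) :
    D t t * b w w ≤ D w w * b t t := by
  have hquad : ∀ (B : LinearMap.BilinForm ℝ M), B.IsSymm → ∀ r : ℝ,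
      B (t + r • w) (t + r • w) = B w w * (r * r) + 2 * B t w * r + B t t := fun B hB r ↦ by
    simp only [map_add, map_smul, LinearMap.add_apply, LinearMap.smul_apply, smul_eq_mul, hB.eq w t]
    ring
  obtain ⟨x, hx⟩ : ∃ x, b w w * (x * x) + 2 * b t w * x + b t t = 0 := by
    refine exists_quadratic_eq_zero hw.ne ⟨√(discrim (b w w) (2 * b t w) (b t t)), ?_⟩
    rw [Real.mul_self_sqrt]
    rw [discrim]
    nlinarith [sq_nonneg (b t w), mul_pos ht (neg_pos.2 hw)]
  have hx0 : x ≠ 0 := fun h ↦ ht.ne' (by simpa [h] using hx)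
  obtain ⟨y, hxy⟩ : ∃ y, b w w * (x * y) = b t t :=
    ⟨b t t / (b w w * x), by field_simp [hw.ne]⟩
  have hy : b w w * (y * y) + 2 * b t w * y + b t t = 0 := by
    have : x ^ 2 * (b w w * (y * y) + 2 * b t w * y + b t t) = 0 := by
      linear_combination (x * y) * hx + (x * y - x ^ 2) * hxy
    exact (mul_eq_zero.1 this).resolve_left (pow_ne_zero 2 hx0)
  have hDx := hnull (t + x • w) (by rw [hquad b hb, hx])
  have hDy := hnull (t + y • w) (by rw [hquad b hb, hy])
  rw [hquad D hD] at hDx hDy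
  have hxy_neg : x * y < 0 := by
    by_contra! h
    exact absurd hxy.ge (not_le.2 ((mul_nonpos_of_nonpos_of_nonneg hw.le h).trans_lt ht))
  have hpos : 0 < x * (x - y) := by nlinarith [sq_nonneg x]
  have hcomb : 0 ≤ x * (x - y) * (D t t - x * y * D w w) := by
    calc 0 ≤ x ^ 2 * (D w w * (y * y) + 2 * D t w * y + D t t)
          + -(x * y) * (D w w * (x * x) + 2 * D t w * x + D t t) :=
          add_nonneg (mul_nonneg (sq_nonneg x) hDy) (mul_nonneg (neg_nonneg.2 hxy_neg.le) hDx)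
      _ = x * (x - y) * (D t t - x * y * D w w) := by ring
  have := mul_le_mul_of_nonpos_right (nonneg_of_mul_nonneg_right hcomb hpos) hw.le
  linear_combination this + D w w * hxy

/-- The S-lemma for indefinite forms; `a` is the infimum of `D t t / b t t` over `b t t > 0`. -/
theorem exists_mul_le_of_nonneg_on_null (hb : b.IsSymm) (hD : D.IsSymm)
    (hnull : ∀ k, b k k = 0 → 0 ≤ D k k) {t w : M} (ht : 0 < b t t) (hw : b w w < 0) :
    ∃ a : ℝ, ∀ v, a * b v v ≤ D v v := by
  set S : Set ℝ := {r | ∃ u, 0 < b u u ∧ D u u / b u u = r}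
  have hlow : ∀ v, b v v < 0 → D v v / b v v ∈ lowerBounds S := by
    rintro v hv _ ⟨u, hu, rfl⟩
    rw [div_le_iff_of_neg hv, div_mul_eq_mul_div, div_le_iff₀ hu]
    exact mul_le_mul_of_nonneg_on_null hb hD hnull hu hv
  refine ⟨sInf S, fun v ↦ ?_⟩
  rcases lt_trichotomy (b v v) 0 with hv | hv | hv
  · exact (div_le_iff_of_neg hv).1 (le_csInf ⟨_, t, ht, rfl⟩ (hlow v hv))
  · rw [hv, mul_zero]
    exact hnull v hv
  · exact (le_div_iff₀ hv).1 (csInf_le ⟨_, hlow w hw⟩ ⟨v, hv, rfl⟩)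

theorem apply_eq_mul_of_null {a : ℝ} (hb : b.IsSymm) (hD : D.IsSymm)
    (ha : ∀ v, a * b v v ≤ D v v) {k : M} (hk : b k k = 0) (hDk : D k k = 0) (v : M) :
    D k v = a * b k v := by
  have hker : k ∈ LinearMap.ker (D - a • b) :=
    (LinearMap.BilinForm.apply_apply_same_eq_zero_iff (D - a • b)
      (fun v ↦ by simpa using ha v)
      (LinearMap.BilinForm.isSymm_iff.1 (hD.sub (hb.smul a)))).1 (by simp [hk, hDk])
  have := LinearMap.congr_fun (LinearMap.mem_ker.1 hker) v
  simpa [sub_eq_zero] using this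

end LorentzForm

section Functionals

variable {K M ι : Type*} [Field K] [AddCommGroup M] [Module K M]
  {θ : ι → Module.Dual K M}

theorem exists_apply_eq_of_linearIndependent [Finite ι] (hθ : LinearIndependent K θ) (y : ι → K) :
    ∃ v, ∀ i, θ i v = y i := by
  classical
  cases nonempty_fintype ι
  have hsurj : Function.Surjective (Fintype.linearCombination K θ).flip :=
    LinearMap.flip_surjective_iff₁.2 (linearIndependent_iff_injective_fintypeLinearCombination.1 hθ)
  obtain ⟨v, hv⟩ := hsurj (Fintype.linearCombination K y)
  refine ⟨v, fun i ↦ ?_⟩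
  simpa [Fintype.linearCombination_apply_single] using
    LinearMap.congr_fun hv (Pi.single i 1)

variable [Fintype ι] [DecidableEq ι]

theorem exists_det_apply_ne_zero (hθ : LinearIndependent K θ) :
    ∃ w : ι → M, (Matrix.of fun i j ↦ θ i (w j)).det ≠ 0 := by
  choose e he using fun j ↦
    exists_apply_eq_of_linearIndependent hθ fun i ↦ (1 : Matrix ι ι K) i j
  refine ⟨e, ?_⟩
  have : (Matrix.of fun i j ↦ θ i (e j)) = 1 := Matrix.ext fun i j ↦ he j i
  rw [this, Matrix.det_one]
  exact one_ne_zero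

theorem forall_det_apply_update_eq_zero_iff (hθ : LinearIndependent K θ) (v : M) :
    (∀ (w : ι → M) (i : ι), (Matrix.of fun l j ↦ θ l (Function.update w i v j)).det = 0) ↔
      ∀ i, θ i v = 0 := by
  refine ⟨fun h i ↦ ?_, fun h w i ↦
    Matrix.det_eq_zero_of_column_eq_zero i fun l ↦ by simp [h]⟩
  choose e he using fun j ↦
    exists_apply_eq_of_linearIndependent hθ fun i ↦ (1 : Matrix ι ι K) i j
  have hcol : (Matrix.of fun l j ↦ θ l (Function.update e i v j)) =
      (1 : Matrix ι ι K).updateCol i fun l ↦ θ l v := by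
    ext l j
    rcases eq_or_ne j i with rfl | hj
    · simp
    · simp [hj, he]
  simpa only [hcol, ← Matrix.cramer_apply, Matrix.cramer_one, Module.End.one_apply] using
    h e i

end Functionals

section Comparison

theorem eventually_eq_zero_of_hasDerivAt_mul {f g β : ℝ → ℝ}
    (hf : ∀ s, HasDerivAt f (β s * f s) s) (hg : ∀ s, HasDerivAt g (β s * g s) s) {r : ℝ}
    (hfr : f r = 0) (hgr : g r ≠ 0) : ∀ᶠ s in 𝓝 r, f s = 0 := by
  obtain ⟨δ, hδ, hball⟩ := Metric.eventually_nhds_iff_ball.1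
    ((hg r).continuousAt.eventually_ne hgr)
  have hquot : ∀ s ∈ Metric.ball r δ, HasDerivAt (fun s ↦ f s / g s) 0 s := fun s hs ↦
    ((hf s).div (hg s) (hball s hs)).congr_deriv (by ring)
  filter_upwards [Metric.ball_mem_nhds r hδ] with s hs
  have hconst : f s / g s = f r / g r := Metric.isOpen_ball.is_const_of_deriv_eq_zero
    (convex_ball r δ).isPreconnected
    (fun x hx ↦ (hquot x hx).differentiableAt.differentiableWithinAt)
    (fun x hx ↦ (hquot x hx).deriv) hs (Metric.mem_ball_self hδ)
  simpa [hfr, hball s hs] using hconst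

theorem eq_zero_of_hasDerivAt_mul {ι : Type*} {c : ℝ → ι → ℝ} {β : ℝ → ℝ}
    (hc : ∀ s i, HasDerivAt (fun s ↦ c s i) (β s * c s i) s) (hne : ∀ s, ∃ i, c s i ≠ 0) {i : ι}
    {r : ℝ} (hr : c r i = 0) (s : ℝ) : c s i = 0 := by
  have hclopen : IsClopen {s | c s i = 0} := by
    refine ⟨isClosed_eq (continuous_iff_continuousAt.2 fun s ↦ (hc s i).continuousAt)
      continuous_const, isOpen_iff_mem_nhds.2 fun s hs ↦ ?_⟩
    obtain ⟨j, hj⟩ := hne s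
    exact eventually_eq_zero_of_hasDerivAt_mul (fun s ↦ hc s i) (fun s ↦ hc s j) hs hj
  exact eq_univ_iff_forall.1 (hclopen.eq_univ ⟨r, hr⟩) s

/-- The wedge product `θ₁ ∧ ⋯ ∧ θ_p` determines the common kernel of the `θᵢ`. -/
theorem forall_apply_eq_zero_iff_of_hasDerivAt_det {M ι : Type*} [AddCommGroup M] [Module ℝ M]
    [Fintype ι] [DecidableEq ι] {θ : ℝ → ι → Module.Dual ℝ M} {β : ℝ → ℝ}
    (hθ : ∀ s, LinearIndependent ℝ (θ s))
    (hdet : ∀ s (w : ι → M), HasDerivAt (fun s ↦ (Matrix.of fun i j ↦ θ s i (w j)).det)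
      (β s * (Matrix.of fun i j ↦ θ s i (w j)).det) s) (r s : ℝ) (v : M) :
    (∀ i, θ r i v = 0) ↔ ∀ i, θ s i v = 0 := by
  suffices h : ∀ r s, (∀ i, θ r i v = 0) → ∀ i, θ s i v = 0 from ⟨h r s, h s r⟩
  intro r s
  rw [← forall_det_apply_update_eq_zero_iff (hθ r), ← forall_det_apply_update_eq_zero_iff (hθ s)]
  exact fun h w i ↦ eq_zero_of_hasDerivAt_mul hdet (fun s ↦ exists_det_apply_ne_zero (hθ s))
    (h w i) s

/-- Wherever `f` is negative, the comparison function `q > 0` makes `f / q` increasing. -/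
theorem nonneg_of_forall_exists_comparison {f : ℝ → ℝ} (hf : Differentiable ℝ f) (h0 : 0 ≤ f 0)
    (hloc : ∀ r, ∃ q : ℝ → ℝ, Differentiable ℝ q ∧
      ∀ᶠ s in 𝓝 r, 0 < q s ∧ (f s < 0 → f s * deriv q s ≤ deriv f s * q s))
    {s : ℝ} (hs : 0 ≤ s) : 0 ≤ f s := by
  refine IsClosed.Icc_subset_of_forall_exists_gt (a := 0) (b := s) (s := {s | 0 ≤ f s})
    ((isClosed_le continuous_const hf.continuous).inter isClosed_Icc) h0 ?_ (right_mem_Icc.2 hs)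
  rintro r ⟨hr, -⟩ y (hry : r < y)
  by_contra hne
  have hneg : ∀ z ∈ Ioc r y, f z < 0 := fun z hz ↦ not_le.1 fun h ↦ hne ⟨z, h, hz⟩
  obtain ⟨q, hq, hev⟩ := hloc r
  obtain ⟨u, hru, hsub⟩ := mem_nhdsGE_iff_exists_Icc_subset.1 (nhdsWithin_le_nhds hev)
  set z := min y u
  have hrz : r < z := lt_min hry hru
  have hqpos : ∀ x ∈ Icc r z, 0 < q x := fun x hx ↦
    (hsub ⟨hx.1, hx.2.trans (min_le_right _ _)⟩).1
  have hmono : MonotoneOn (fun x ↦ f x / q x) (Icc r z) := by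
    refine monotoneOn_of_deriv_nonneg (convex_Icc r z)
      (hf.continuous.continuousOn.div hq.continuous.continuousOn fun x hx ↦ (hqpos x hx).ne')
      (fun x hx ↦ ((hf x).div (hq x)
        (hqpos x (interior_subset hx)).ne').differentiableWithinAt) fun x hx ↦ ?_
    rw [interior_Icc] at hx
    have hqx := hqpos x (Ioo_subset_Icc_self hx)
    rw [deriv_fun_div (hf x) (hq x) hqx.ne']
    exact div_nonneg (sub_nonneg.2 ((hsub ⟨hx.1.le, hx.2.le.trans (min_le_right _ _)⟩).2
      (hneg x ⟨hx.1, hx.2.le.trans (min_le_left _ _)⟩))) (sq_nonneg _)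
  have hle : f r / q r ≤ f z / q z :=
    hmono (left_mem_Icc.2 hrz.le) (right_mem_Icc.2 hrz.le) hrz.le
  exact absurd ((div_nonneg hr (hqpos r (left_mem_Icc.2 hrz.le)).le).trans hle)
    (not_le.2 (div_neg_of_neg_of_pos (hneg z ⟨hrz, min_le_left _ _⟩)
      (hqpos z (right_mem_Icc.2 hrz.le))))

end Comparison

section Span

variable {M : Type*} [AddCommGroup M] [Module ℝ M] {b D : LinearMap.BilinForm ℝ M}

theorem mem_orthogonal_span_iff {S : Set M} {v : M} :
    v ∈ b.orthogonal (Submodule.span ℝ S) ↔ ∀ k ∈ S, b k v = 0 :=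
  Submodule.span_le (p := LinearMap.ker (b.flip v))

theorem IsLorentzForm.exists_timelike_mem_span (hb : IsLorentzForm b) {ι : Type*} [Nontrivial ι]
    {k : ι → M} (hk : LinearIndependent ℝ k) (hnull : ∀ i, b (k i) (k i) = 0) :
    ∃ t ∈ Submodule.span ℝ (range k), 0 < b t t := by
  obtain ⟨i, j, hij⟩ := exists_pair_ne ι
  have hpair : LinearIndependent ℝ ![k i, k j] := by
    rw [show ![k i, k j] = k ∘ ![i, j] by ext l; fin_cases l <;> rfl]
    exact hk.comp _ (by simp [Function.Injective, Fin.forall_fin_two, hij, hij.symm])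
  obtain ⟨c, hc⟩ := hb.exists_timelike_add_smul hpair (hnull i) (hnull j)
  exact ⟨_, Submodule.add_mem _ (Submodule.subset_span ⟨i, rfl⟩)
    (Submodule.smul_mem _ c (Submodule.subset_span ⟨j, rfl⟩)), hc⟩

theorem IsLorentzForm.exists_apply_eq_mul_of_mem_span (hb : IsLorentzForm b) (hD : D.IsSymm)
    (hnonneg : ∀ k, b k k = 0 → 0 ≤ D k k) {S : Set M} (hS : ∃ k ∈ S, k ≠ 0)
    (hnull : ∀ k ∈ S, b k k = 0 ∧ D k k = 0) :
    ∃ a : ℝ, ∀ w ∈ Submodule.span ℝ S, ∀ v, D w v = a * b w v := by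
  obtain ⟨k, hk, hk0⟩ := hS
  obtain ⟨t, ht, -⟩ := hb.exists_timelike
  obtain ⟨w, hw⟩ := hb.exists_spacelike hk0 (hnull k hk).1
  obtain ⟨a, ha⟩ := exists_mul_le_of_nonneg_on_null hb.toIsSymm hD hnonneg ht hw
  have hspan : Submodule.span ℝ S ≤ LinearMap.ker (D - a • b) := Submodule.span_le.2 fun k hk ↦
    LinearMap.ext fun v ↦ by
      simp [apply_eq_mul_of_null hb.toIsSymm hD ha (hnull k hk).1 (hnull k hk).2 v]
  refine ⟨a, fun w hw v ↦ ?_⟩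
  simpa [sub_eq_zero] using LinearMap.congr_fun (LinearMap.mem_ker.1 (hspan hw)) v

end Span

section Curve

theorem isInvertible_of_forall_apply_eq_zero {N : Type*} [NormedAddCommGroup N] [NormedSpace ℝ N]
    [FiniteDimensional ℝ N] {G : N →L[ℝ] N →L[ℝ] ℝ} (hG : ∀ m, G m = 0 → m = 0) :
    G.IsInvertible := by
  have hrank : Module.finrank ℝ N = Module.finrank ℝ (N →L[ℝ] ℝ) := by
    rw [← (LinearMap.toContinuousLinearMap (𝕜 := ℝ) (E := N) (F' := ℝ)).finrank_eq]
    exact Subspace.dual_finrank_eq.symm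
  exact ⟨(LinearEquiv.ofInjectiveOfFinrankEq G.toLinearMap
    ((injective_iff_map_eq_zero G).2 hG) hrank).toContinuousLinearEquiv, rfl⟩

theorem exists_hasDerivAt_of_contDiff_apply {E F : Type*} [NormedAddCommGroup E] [NormedSpace ℝ E]
    [FiniteDimensional ℝ E] [NormedAddCommGroup F] [NormedSpace ℝ F] {A : ℝ → E →L[ℝ] F}
    (hA : ∀ v, ContDiff ℝ 1 fun s ↦ A s v) : ∃ A' : ℝ → E →L[ℝ] F, ∀ s, HasDerivAt A (A' s) s :=
  ⟨deriv A, fun s ↦ ((contDiff_clm_apply_iff.2 hA).differentiable one_ne_zero s).hasDerivAt⟩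

variable {E : Type*} [NormedAddCommGroup E] [NormedSpace ℝ E] {B B' : ℝ → E →L[ℝ] E →L[ℝ] ℝ}

theorem hasDerivAt_apply_apply {s : ℝ} {D : E →L[ℝ] E →L[ℝ] ℝ} (h : HasDerivAt B D s) (u v : E) :
    HasDerivAt (fun s ↦ B s u v) (D u v) s := by
  simpa using (h.clm_apply (hasDerivAt_const s u)).clm_apply (hasDerivAt_const s v)

/-- The solution `m s` of `G s (m s) = f s` satisfies `G s (m' s) = f' s - G' s (m s) = 0`. -/
theorem inverse_apply_eq_of_hasDerivAt {N P : Type*} [NormedAddCommGroup N] [NormedSpace ℝ N]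
    [CompleteSpace N] [NormedAddCommGroup P] [NormedSpace ℝ P] {G G' : ℝ → N →L[ℝ] P}
    {f f' : ℝ → P} (hG : ∀ s, HasDerivAt G (G' s) s) (hf : ∀ s, HasDerivAt f (f' s) s)
    (hinv : ∀ s, (G s).IsInvertible) (h : ∀ s m, G s m = f s → G' s m = f' s) (r s : ℝ) :
    (G s).inverse (f s) = (G r).inverse (f r) := by
  have hGm (s) : G s ((G s).inverse (f s)) = f s := (hinv s).self_apply_inverse _
  have hm : Differentiable ℝ fun s ↦ (G s).inverse (f s) := fun s ↦
    ((((hinv s).contDiffAt_map_inverse (n := 1)).differentiableAt (by simp)).comp s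
      (hG s).differentiableAt).clm_apply (hf s).differentiableAt
  refine is_const_of_deriv_eq_zero hm (fun s ↦ (hinv s).injective ?_) s r
  have hsum := ((hG s).clm_apply (hm s).hasDerivAt).unique
    ((hf s).congr_of_eventuallyEq (Eventually.of_forall hGm))
  rwa [h s _ (hGm s), add_eq_left, ← map_zero (G s)] at hsum

theorem orthogonal_of_orthogonal {N : Type*} [NormedAddCommGroup N] [NormedSpace ℝ N]
    [FiniteDimensional ℝ N] {i : N →L[ℝ] E} (hB : ∀ s, HasDerivAt B (B' s) s)
    (hi : ∀ s m, (∀ n, B s (i m) (i n) = 0) → m = 0)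
    (hB' : ∀ s v, (∀ n, B s v (i n) = 0) → ∀ n, B' s v (i n) = 0) {v : E} {r : ℝ}
    (hr : ∀ n, B r v (i n) = 0) (s : ℝ) : ∀ n, B s v (i n) = 0 := by
  let R : (E →L[ℝ] ℝ) →L[ℝ] N →L[ℝ] ℝ := ContinuousLinearMap.precomp ℝ i
  have hR (f : E →L[ℝ] ℝ) : R f = 0 ↔ ∀ n, f (i n) = 0 := ContinuousLinearMap.ext_iff
  have hG (s) : HasDerivAt (fun s ↦ R ∘L B s ∘L i) (R ∘L B' s ∘L i) s := by
    simpa using (hasDerivAt_const s R).clm_comp ((hB s).clm_comp (hasDerivAt_const s i))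
  have hf (s) : HasDerivAt (fun s ↦ R (B s v)) (R (B' s v)) s := by
    simpa using (hasDerivAt_const s R).clm_apply ((hB s).clm_apply (hasDerivAt_const s v))
  have hinv (s) : (R ∘L B s ∘L i).IsInvertible :=
    isInvertible_of_forall_apply_eq_zero fun m hm ↦ hi s m ((hR _).1 hm)
  have hm := inverse_apply_eq_of_hasDerivAt hG hf hinv (fun s m h ↦ ?_) r s
  · rw [(hR _).2 hr, map_zero] at hm
    rw [← hR, ← (hinv s).self_apply_inverse (R (B s v)), hm, map_zero]
  · have hperp := (hR _).2 (hB' s (v - i m) ((hR _).1 ?_))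
    · rw [map_sub, map_sub, sub_eq_zero] at hperp
      exact hperp.symm
    · rw [map_sub, map_sub, sub_eq_zero]
      exact h.symm

theorem null_of_timelike [FiniteDimensional ℝ E] (hB : ∀ s, HasDerivAt B (B' s) s)
    (hlor : ∀ s, IsLorentzForm (B s).toBilinForm) {W : ℝ → Submodule ℝ E} {N : Submodule ℝ E}
    (hN : ∀ s, (B s).toBilinForm.orthogonal (W s) = N) (htime : ∀ s, ∃ t ∈ W s, 0 < B s t t)
    {a : ℝ → ℝ} (hW : ∀ s, ∀ w ∈ W s, ∀ v, B' s w v = a s * B s w v)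
    {k : E} {r : ℝ} (hk : k ∈ W r) (hk0 : B r k k = 0) (s : ℝ) : B s k k = 0 := by
  have hneg (s) (n) (hn : n ∈ N) (hn0 : n ≠ 0) : B s n n < 0 := by
    obtain ⟨t, ht, htt⟩ := htime s
    rw [← hN s] at hn
    exact (hlor s).neg_of_orthogonal htt (hn t ht) hn0
  have hmemW (s v) : v ∈ W s ↔ ∀ n ∈ N, B s v n = 0 := by
    have hperp := LinearMap.BilinForm.orthogonal_orthogonal
      (LinearMap.BilinForm.nondegenerate_iff_ker_eq_bot.2 (hlor s).ker_eq_bot)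
      (hlor s).isRefl (W s)
    rw [hN s] at hperp
    rw [← hperp, LinearMap.BilinForm.mem_orthogonal_iff]
    exact forall₂_congr fun n _ ↦ by rw [← (hlor s).eq v n]; rfl
  have hconst (q s) (v) (hv : v ∈ W q) : v ∈ W s := by
    refine (hmemW s v).2 fun n hn ↦ orthogonal_of_orthogonal (i := N.subtypeL) hB
      (fun s m h ↦ ?_) (fun s v hv n ↦ ?_) (fun n ↦ (hmemW q v).1 hv n n.2) s ⟨n, hn⟩
    · by_contra hm
      exact (hneg s m m.2 fun h0 ↦ hm (Subtype.ext h0)).ne (h m)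
    · have hvW := (hmemW s v).2 fun n hn ↦ hv ⟨n, hn⟩
      rw [hW s v hvW, hv n, mul_zero]
  refine eq_zero_of_hasDerivAt_mul (ι := W r) (c := fun s w ↦ B s w w) (β := a) (i := ⟨k, hk⟩)
    (fun s w ↦ ?_) (fun s ↦ ?_) hk0 s
  · rw [← hW s w (hconst r s w w.2)]
    exact hasDerivAt_apply_apply (hB s) _ _
  · obtain ⟨t, ht, htt⟩ := htime s
    exact ⟨⟨t, hconst s r t ht⟩, ne_of_gt htt⟩

/-- A curve `B` of Lorentzian forms whose derivative `B'` is nonnegative on the null vectors. -/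
structure IsExpandingCurve (B B' : ℝ → E →L[ℝ] E →L[ℝ] ℝ) : Prop where
  hasDerivAt : ∀ s, HasDerivAt B (B' s) s
  isLorentzForm : ∀ s, IsLorentzForm (B s).toBilinForm
  deriv_nonneg : ∀ s k, B s k k = 0 → 0 ≤ B' s k k

namespace IsExpandingCurve

theorem isSymm_deriv (hB : IsExpandingCurve B B') (s : ℝ) : (B' s).toBilinForm.IsSymm :=
  ⟨fun u v ↦ (hasDerivAt_apply_apply (hB.hasDerivAt s) u v).unique
    ((hasDerivAt_apply_apply (hB.hasDerivAt s) v u).congr_of_eventuallyEq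
      (Eventually.of_forall fun r ↦ (hB.isLorentzForm r).eq u v))⟩

theorem nonneg_of_nonneg (hB : IsExpandingCurve B B') {v : E} (hv : 0 ≤ B 0 v v) {s : ℝ}
    (hs : 0 ≤ s) : 0 ≤ B s v v := by
  have hd (v s) := hasDerivAt_apply_apply (hB.hasDerivAt s) v v
  refine nonneg_of_forall_exists_comparison (fun s ↦ (hd v s).differentiableAt) hv (fun r ↦ ?_) hs
  obtain ⟨t, ht, -⟩ := (hB.isLorentzForm r).exists_timelike
  refine ⟨fun s ↦ B s t t, fun s ↦ (hd t s).differentiableAt, ?_⟩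
  filter_upwards [(hd t r).continuousAt.eventually (lt_mem_nhds ht)] with s hst
  refine ⟨hst, fun hsv ↦ ?_⟩
  rw [(hd t s).deriv, (hd v s).deriv, mul_comm]
  exact mul_le_mul_of_nonneg_on_null (hB.isLorentzForm s).toIsSymm (hB.isSymm_deriv s)
    (hB.deriv_nonneg s) hst hsv

theorem null_of_mem_span [FiniteDimensional ℝ E] (hB : IsExpandingCurve B B') {ι : Type*}
    {k : ℝ → ι → E} (hli : ∀ s, LinearIndependent ℝ (k s))
    (hnull : ∀ s i, B s (k s i) (k s i) = 0) (hnull' : ∀ s i, B' s (k s i) (k s i) = 0)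
    (hperp : ∀ s v, (∀ i, B s (k s i) v = 0) ↔ ∀ i, B 0 (k 0 i) v = 0)
    {v : E} (hv : v ∈ Submodule.span ℝ (range (k 0))) (hv0 : v ≠ 0) (hvn : B 0 v v = 0) {s : ℝ}
    (hs : 0 ≤ s) : B s v v = 0 := by
  obtain hι | ⟨⟨i⟩⟩ := isEmpty_or_nonempty ι
  · simp [range_eq_empty, hv0] at hv
  obtain hι | hι := subsingleton_or_nontrivial ι
  · have := uniqueOfSubsingleton i
    rw [range_unique] at hv
    obtain ⟨c, rfl⟩ := Submodule.mem_span_singleton.1 hv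
    have hc : B s (k s default) (c • k 0 default) = 0 :=
      (hperp s _).2 (fun i ↦ by rw [Subsingleton.elim i default, map_smul, hnull, smul_zero]) _
    exact le_antisymm
      ((hB.isLorentzForm s).nonpos_of_orthogonal_null ((hli s).ne_zero _) (hnull s _) hc)
      (hB.nonneg_of_nonneg hvn.ge hs)
  · choose a ha using fun s ↦ (hB.isLorentzForm s).exists_apply_eq_mul_of_mem_span
      (hB.isSymm_deriv s) (hB.deriv_nonneg s) ⟨k s i, mem_range_self i, (hli s).ne_zero i⟩
      (by rintro _ ⟨j, rfl⟩; exact ⟨hnull s j, hnull' s j⟩)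
    refine null_of_timelike hB.hasDerivAt hB.isLorentzForm
      (W := fun s ↦ Submodule.span ℝ (range (k s)))
      (N := (B 0).toBilinForm.orthogonal (Submodule.span ℝ (range (k 0))))
      (fun s ↦ Submodule.ext fun v ↦ ?_)
      (fun s ↦ (hB.isLorentzForm s).exists_timelike_mem_span (hli s) (hnull s)) ha hv hvn s
    rw [mem_orthogonal_span_iff, mem_orthogonal_span_iff, forall_mem_range, forall_mem_range]
    exact hperp s v

end IsExpandingCurve

end Curve

section Pullback

variable {E : Type*} [NormedAddCommGroup E] [NormedSpace ℝ E]
  {V : Type*} [TopologicalSpace V] [ChartedSpace E V]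

theorem contMDiffAt_inTangentCoordinates_push [IsManifold 𝓘(ℝ, E) ∞ V] {φ : ℝ → V → V}
    {m n : WithTop ℕ∞} (hmn : m + 1 ≤ n)
    (hφ : ContMDiff (𝓘(ℝ, ℝ).prod 𝓘(ℝ, E)) 𝓘(ℝ, E) n (Function.uncurry φ)) (x : V)
    (u : TangentSpace 𝓘(ℝ, E) x) (s₀ : ℝ) :
    ContMDiffAt 𝓘(ℝ, ℝ) 𝓘(ℝ, E) m (fun s ↦ inTangentCoordinates 𝓘(ℝ, E) 𝓘(ℝ, E)
      (fun _ ↦ x) (fun s ↦ φ s x) (fun s ↦ push (φ s) x) s₀ s (u : E)) s₀ := by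
  have : IsManifold 𝓘(ℝ, E) 1 V := IsManifold.of_le (n := ∞) (by simp)
  exact (ContMDiffAt.mfderiv (J := 𝓘(ℝ, ℝ)) φ (fun _ ↦ x) (hφ (s₀, x)) contMDiffAt_const
    hmn).clm_apply contMDiffAt_const

theorem inTangentCoordinates_push_apply [IsManifold 𝓘(ℝ, E) ∞ V] {φ : ℝ → V → V} {x : V}
    (u : TangentSpace 𝓘(ℝ, E) x) {s₀ s : ℝ} (hs : φ s x ∈ (chartAt E (φ s₀ x)).source) :
    inTangentCoordinates 𝓘(ℝ, E) 𝓘(ℝ, E) (fun _ ↦ x) (fun s ↦ φ s x) (fun s ↦ push (φ s) x)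
      s₀ s (u : E) = (tangentBundleCore 𝓘(ℝ, E) V).coordChange (achart E (φ s x))
        (achart E (φ s₀ x)) (φ s x) (push (φ s) x u) := by
  have hcoord := inTangentCoordinates_eq (I := 𝓘(ℝ, E)) (I' := 𝓘(ℝ, E)) (fun _ ↦ x)
    (fun s ↦ φ s x) (fun s ↦ push (φ s) x) (x₀ := s₀) (mem_chart_source E x) hs
  have hself : (tangentBundleCore 𝓘(ℝ, E) V).coordChange (achart E x) (achart E x) x (u : E) = u :=
    (tangentBundleCore 𝓘(ℝ, E) V).coordChange_self (achart E x) x (mem_chart_source E x) u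
  exact (DFunLike.congr_fun hcoord u).trans (congrArg (fun w : E ↦
    (tangentBundleCore 𝓘(ℝ, E) V).coordChange (achart E (φ s x)) (achart E (φ s₀ x)) (φ s x)
      (push (φ s) x w)) hself)

theorem contMDiff_push [IsManifold 𝓘(ℝ, E) ∞ V] {φ : ℝ → V → V} {m n : WithTop ℕ∞}
    (hmn : m + 1 ≤ n) (hφ : ContMDiff (𝓘(ℝ, ℝ).prod 𝓘(ℝ, E)) 𝓘(ℝ, E) n (Function.uncurry φ))
    (x : V) (u : TangentSpace 𝓘(ℝ, E) x) :
    ContMDiff 𝓘(ℝ, ℝ) 𝓘(ℝ, E).tangent m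
      (fun s ↦ (⟨φ s x, push (φ s) x u⟩ : TangentBundle 𝓘(ℝ, E) V)) := by
  intro s₀
  have hcurve : ContMDiffAt 𝓘(ℝ, ℝ) 𝓘(ℝ, E) n (fun s ↦ φ s x) s₀ :=
    ContMDiffAt.comp (I' := 𝓘(ℝ, ℝ).prod 𝓘(ℝ, E)) (g := Function.uncurry φ) s₀
      (hφ (s₀, x)) (contMDiffAt_id.prodMk contMDiffAt_const)
  refine Bundle.contMDiffAt_totalSpace.2 ⟨hcurve.of_le (le_self_add.trans hmn), ?_⟩
  refine (contMDiffAt_inTangentCoordinates_push hmn hφ x u s₀).congr_of_eventuallyEq ?_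
  filter_upwards [hcurve.continuousAt.eventually ((chartAt E (φ s₀ x)).open_source.mem_nhds
    (mem_chart_source E (φ s₀ x)))] with s hs
  exact (inTangentCoordinates_push_apply u hs).symm

variable [IsManifold 𝓘(ℝ, E) ∞ V] {ξ : ∀ x : V, TangentSpace 𝓘(ℝ, E) x} {φ : ℝ → V → V}

namespace LorentzMetric

theorem contDiff_form_apply (g : LorentzMetric E V) {n : WithTop ℕ∞} (hn : n ≤ 1)
    {c : ℝ → V} {u v : ∀ s, TangentSpace 𝓘(ℝ, E) (c s)}
    (hu : ContMDiff 𝓘(ℝ, ℝ) 𝓘(ℝ, E).tangent n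
      (fun s ↦ (⟨c s, u s⟩ : TangentBundle 𝓘(ℝ, E) V)))
    (hv : ContMDiff 𝓘(ℝ, ℝ) 𝓘(ℝ, E).tangent n
      (fun s ↦ (⟨c s, v s⟩ : TangentBundle 𝓘(ℝ, E) V))) :
    ContDiff ℝ n (fun s ↦ g.form (c s) (u s) (v s)) := by
  have : IsManifold 𝓘(ℝ, E) 1 V := IsManifold.of_le (n := ∞) (by simp)
  rw [← contMDiff_iff_contDiff]
  intro s
  have hc : ContMDiffAt 𝓘(ℝ, ℝ) 𝓘(ℝ, E) n c s := (Bundle.contMDiffAt_totalSpace.1 (hu s)).1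
  have hg := ContMDiffAt.comp s ((g.contMDiff_form.of_le hn) (c s)) hc
  have hguv : ContMDiffAt 𝓘(ℝ, ℝ) (𝓘(ℝ, E).prod 𝓘(ℝ)) n
      (fun s ↦ Bundle.TotalSpace.mk' ℝ (E := Bundle.Trivial V ℝ) (c s)
        (g.form (c s) (u s) (v s))) s :=
    ContMDiffAt.clm_bundle_apply₂ (F₁ := E) (F₂ := E) hg (hu s) (hv s)
  exact (Bundle.contMDiffAt_totalSpace.1 hguv).2

theorem isLorentzForm (g : LorentzMetric E V) (x : V) : IsLorentzForm (g.form x).toBilinForm where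
  eq := g.symm x
  exists_timelike := g.lorentzian x

/-- The pulled back metric `φ_s^* g` at `x`, read as a bilinear form on the model space. -/
noncomputable def pullback (g : LorentzMetric E V) (φ : ℝ → V → V) (x : V) (s : ℝ) :
    E →L[ℝ] E →L[ℝ] ℝ :=
  ContinuousLinearMap.bilinearComp (E := E) (F := E) (E' := E) (F' := E) (g.form (φ s x))
    (push (φ s) x) (push (φ s) x)

theorem pullback_apply (g : LorentzMetric E V) (φ : ℝ → V → V) (x : V) (s : ℝ)
    (u v : TangentSpace 𝓘(ℝ, E) x) :
    g.pullback φ x s u v = g.form (φ s x) (push (φ s) x u) (push (φ s) x v) := rfl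

end LorentzMetric

namespace IsSmoothFlow

theorem apply_push_zero (hφ : IsSmoothFlow ξ φ) {ι α : Sort*}
    (F : ∀ y : V, (ι → TangentSpace 𝓘(ℝ, E) y) → α) (x : V) (u : ι → TangentSpace 𝓘(ℝ, E) x) :
    (F (φ 0 x) fun i ↦ push (φ 0) x (u i)) = F x u := by
  rw [show φ 0 = id from funext hφ.map_zero, push, mfderiv_id]
  rfl

theorem pullback_zero (hφ : IsSmoothFlow ξ φ) (g : LorentzMetric E V) (x : V)
    (u v : TangentSpace 𝓘(ℝ, E) x) : g.pullback φ x 0 u v = g.form x u v :=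
  hφ.apply_push_zero (fun y w ↦ g.form y (w 0) (w 1)) x ![u, v]

variable [T2Space V] [FiniteDimensional ℝ E]

theorem apply_push_add (hφ : IsSmoothFlow ξ φ) {ι α : Sort*}
    (F : ∀ y : V, (ι → TangentSpace 𝓘(ℝ, E) y) → α) (s t : ℝ) (x : V)
    (u : ι → TangentSpace 𝓘(ℝ, E) x) :
    (F (φ (s + t) x) fun i ↦ push (φ (s + t)) x (u i)) =
      F (φ s (φ t x)) fun i ↦ push (φ s) (φ t x) (push (φ t) x (u i)) := by
  rw [show φ (s + t) = φ s ∘ φ t from funext (hφ.map_add s t), push,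
    mfderiv_comp x ((hφ.contMDiff_time s).mdifferentiableAt (by simp))
      ((hφ.contMDiff_time t).mdifferentiableAt (by simp))]
  rfl

/-- `F` stands for a covariant tensor field and `F'` for its Lie derivative. -/
theorem hasDerivAt_apply_push (hφ : IsSmoothFlow ξ φ) {ι : Sort*}
    {F F' : ∀ y : V, (ι → TangentSpace 𝓘(ℝ, E) y) → ℝ}
    (hF : ∀ y w, HasDerivAt (fun s ↦ F (φ s y) fun i ↦ push (φ s) y (w i)) (F' y w) 0) (s : ℝ)
    (x : V) (u : ι → TangentSpace 𝓘(ℝ, E) x) :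
    HasDerivAt (fun s ↦ F (φ s x) fun i ↦ push (φ s) x (u i))
      (F' (φ s x) fun i ↦ push (φ s) x (u i)) s := by
  let f : ℝ → ℝ := fun s ↦ F (φ s x) fun i ↦ push (φ s) x (u i)
  have hf : HasDerivAt (fun r ↦ f (r + s)) (F' (φ s x) fun i ↦ push (φ s) x (u i)) (s - s) := by
    simpa only [f, sub_self, hφ.apply_push_add F] using hF (φ s x) fun i ↦ push (φ s) x (u i)
  simpa only [sub_add_cancel] using hf.comp_sub_const s s

/-- The time `s` map of the flow as a diffeomorphism. -/
def diffeomorph (hφ : IsSmoothFlow ξ φ) (s : ℝ) : V ≃ₘ^∞⟮𝓘(ℝ, E), 𝓘(ℝ, E)⟯ V where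
  toFun := φ s
  invFun := φ (-s)
  left_inv x := by rw [← hφ.map_add, neg_add_cancel, hφ.map_zero]
  right_inv x := by rw [← hφ.map_add, add_neg_cancel, hφ.map_zero]
  contMDiff_toFun := hφ.contMDiff_time s
  contMDiff_invFun := hφ.contMDiff_time (-s)

theorem push_bijective (hφ : IsSmoothFlow ξ φ) (s : ℝ) (x : V) :
    Function.Bijective (push (E := E) (φ s) x) :=
  ((hφ.diffeomorph s).mfderivToContinuousLinearEquiv (by simp) x).bijective

theorem contDiff_pullback_apply (hφ : IsSmoothFlow ξ φ) (g : LorentzMetric E V) (x : V)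
    (u v : TangentSpace 𝓘(ℝ, E) x) : ContDiff ℝ 1 fun s ↦ g.pullback φ x s u v := by
  have hpush := contMDiff_push (m := 1) (by norm_cast) hφ.contMDiff_uncurry x
  simp only [LorentzMetric.pullback_apply]
  exact g.contDiff_form_apply le_rfl (hpush u) (hpush v)

theorem hasDerivAt_pullback_apply (hφ : IsSmoothFlow ξ φ) (g : LorentzMetric E V) (x : V) (s : ℝ)
    (u v : TangentSpace 𝓘(ℝ, E) x) : HasDerivAt (fun s ↦ g.pullback φ x s u v)
      (lieMetric g φ (φ s x) (push (φ s) x u) (push (φ s) x v)) s := by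
  have hzero (y : V) (w : Fin 2 → TangentSpace 𝓘(ℝ, E) y) :
      HasDerivAt (fun s ↦ g.form (φ s y) (push (φ s) y (w 0)) (push (φ s) y (w 1)))
        (lieMetric g φ y (w 0) (w 1)) 0 :=
    ((hφ.contDiff_pullback_apply g y (w 0) (w 1)).differentiable one_ne_zero 0).hasDerivAt
  exact hφ.hasDerivAt_apply_push (F := fun y w ↦ g.form y (w 0) (w 1))
    (F' := fun y w ↦ lieMetric g φ y (w 0) (w 1)) hzero s x ![u, v]

theorem isLorentzForm_pullback (hφ : IsSmoothFlow ξ φ) (g : LorentzMetric E V) (x : V) (s : ℝ) :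
    IsLorentzForm (g.pullback φ x s).toBilinForm :=
  (g.isLorentzForm (φ s x)).comp_of_bijective (f := (push (φ s) x).toLinearMap)
    (hφ.push_bijective s x)

end IsSmoothFlow

end Pullback

section CausalSymmetry

variable {E : Type*} [NormedAddCommGroup E] [NormedSpace ℝ E]
  {V : Type*} [TopologicalSpace V] [ChartedSpace E V] [IsManifold 𝓘(ℝ, E) ∞ V]
  {ξ : ∀ x : V, TangentSpace 𝓘(ℝ, E) x} {φ : ℝ → V → V} {g : LorentzMetric E V}
  {τ : TimeOrientation g}

theorem lieMetric_nonneg_of_isFutureTensor {x : V} {a : ℝ}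
    (h : IsFutureTensor g τ x fun u v ↦ lieMetric g φ x u v - a * g.form x u v)
    {k : TangentSpace 𝓘(ℝ, E) x} (hk : g.form x k k = 0) : 0 ≤ lieMetric g φ x k k := by
  rcases eq_or_ne k 0 with rfl | hk0
  · simp [lieMetric]
  have hne : g.form x (τ.field x) k ≠ 0 :=
    (g.isLorentzForm x).apply_ne_zero_of_causal (τ.timelike x) hk.ge hk0
  rcases hne.lt_or_gt with hpast | hfuture
  · have hneg : IsFutureDirected g τ x (-k) :=
      ⟨by simp [hk], by rw [map_neg]; exact neg_pos.2 hpast⟩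
    simpa [hk, lieMetric] using h _ _ hneg hneg
  · simpa [hk] using h k k ⟨hk.ge, hfuture⟩ ⟨hk.ge, hfuture⟩

namespace IsSmoothFlow

variable [T2Space V] [FiniteDimensional ℝ E]

theorem exists_isExpandingCurve_pullback (hφ : IsSmoothFlow ξ φ)
    (hnull : ∀ x k, g.form x k k = 0 → 0 ≤ lieMetric g φ x k k) (x : V) :
    ∃ B' : ℝ → E →L[ℝ] E →L[ℝ] ℝ, IsExpandingCurve (g.pullback φ x) B' ∧
      ∀ s (u v : TangentSpace 𝓘(ℝ, E) x),
        B' s u v = lieMetric g φ (φ s x) (push (φ s) x u) (push (φ s) x v) := by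
  obtain ⟨B', hB'⟩ := exists_hasDerivAt_of_contDiff_apply (A := g.pullback φ x) fun u ↦
    contDiff_clm_apply_iff.2 fun v : E ↦ hφ.contDiff_pullback_apply g x u v
  have hlie (s) (u v : TangentSpace 𝓘(ℝ, E) x) :
      B' s u v = lieMetric g φ (φ s x) (push (φ s) x u) (push (φ s) x v) :=
    (hasDerivAt_apply_apply (hB' s) u v).unique (hφ.hasDerivAt_pullback_apply g x s u v)
  exact ⟨B', ⟨hB', hφ.isLorentzForm_pullback g x, fun s k hk ↦
    (hnull (φ s x) (push (φ s) x k) hk).trans_eq (hlie s k k).symm⟩, hlie⟩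

theorem continuous_form_field_push (hφ : IsSmoothFlow ξ φ) (τ : TimeOrientation g) (x : V)
    (v : TangentSpace 𝓘(ℝ, E) x) :
    Continuous fun s ↦ g.form (φ s x) (τ.field (φ s x)) (push (φ s) x v) := by
  have hfield : Continuous fun s ↦ (⟨φ s x, τ.field (φ s x)⟩ : TangentBundle 𝓘(ℝ, E) V) :=
    τ.continuous_field.comp (hφ.isMIntegralCurve x).continuous
  have hpush := contMDiff_push (m := 0) (by norm_cast) hφ.contMDiff_uncurry x v
  exact (g.contDiff_form_apply zero_le_one (contMDiff_zero_iff.2 hfield) hpush).continuous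

theorem isFutureDirected_push (hφ : IsSmoothFlow ξ φ)
    (hnull : ∀ x k, g.form x k k = 0 → 0 ≤ lieMetric g φ x k k) {x : V}
    {v : TangentSpace 𝓘(ℝ, E) x} (hv : IsFutureDirected g τ x v) {s : ℝ} (hs : 0 ≤ s) :
    IsFutureDirected g τ (φ s x) (push (φ s) x v) := by
  obtain ⟨B', hB, -⟩ := hφ.exists_isExpandingCurve_pullback hnull x
  have hcausal (r : ℝ) (hr : 0 ≤ r) : 0 ≤ g.form (φ r x) (push (φ r) x v) (push (φ r) x v) := by
    rw [← g.pullback_apply]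
    exact hB.nonneg_of_nonneg ((hφ.pullback_zero g x v v).symm ▸ hv.1) hr
  have hv0 : v ≠ 0 := by
    rintro rfl
    simpa using hv.2
  have hne (r : ℝ) (hr : 0 ≤ r) : g.form (φ r x) (τ.field (φ r x)) (push (φ r) x v) ≠ 0 :=
    (g.isLorentzForm (φ r x)).apply_ne_zero_of_causal (τ.timelike (φ r x)) (hcausal r hr)
      ((map_ne_zero_iff _ (hφ.push_bijective r x).1).2 hv0)
  have hzero : g.form (φ 0 x) (τ.field (φ 0 x)) (push (φ 0) x v) = g.form x (τ.field x) v :=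
    hφ.apply_push_zero (fun y w ↦ g.form y (τ.field y) (w ())) x fun _ ↦ v
  refine ⟨hcausal s hs, ?_⟩
  by_contra! hpast
  obtain ⟨r, hr, hr0⟩ := intermediate_value_Icc' hs
    (hφ.continuous_form_field_push τ x v).continuousOn ⟨hpast, hzero.symm ▸ hv.2.le⟩
  exact hne r hr.1 hr0

theorem isCausalPreserving (hφ : IsSmoothFlow ξ φ) (τ : TimeOrientation g)
    (hnull : ∀ x k, g.form x k k = 0 → 0 ≤ lieMetric g φ x k k) : IsCausalPreserving g τ ξ :=
  ⟨φ, hφ.toIsFlow, Ici 0, ordConnected_Ici, self_mem_Ici, ⟨1, mem_Ici.2 zero_le_one, one_pos⟩,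
    fun s _ hs ↦ ⟨⟨hφ.diffeomorph s, rfl⟩, fun _ _ hv ↦ hφ.isFutureDirected_push hnull hv hs⟩⟩

theorem canonicalNullDirections_subset (hφ : IsSmoothFlow ξ φ) {J : Set ℝ}
    (hJ : IsCausalSubmonoid g τ φ J) : canonicalNullDirections g φ J ⊆ muSet g φ := by
  obtain ⟨hord, h0J, ⟨ε, hεJ, hε⟩, -⟩ := hJ
  rintro ⟨x, k⟩ ⟨hk0, hk, hcan⟩
  simp only [← LorentzMetric.pullback_apply] at hcan
  refine ⟨hk0, hk, ?_⟩
  have hlie : HasDerivAt (fun s ↦ g.pullback φ x s k k) (lieMetric g φ x k k) 0 :=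
    ((hφ.contDiff_pullback_apply g x k k).differentiable one_ne_zero 0).hasDerivAt
  have hzero : HasDerivWithinAt (fun s ↦ g.pullback φ x s k k) 0 (Ici 0) 0 := by
    refine (hasDerivWithinAt_const (0 : ℝ) (Ici 0) (0 : ℝ)).congr_of_eventuallyEq ?_
      (hcan 0 h0J le_rfl)
    filter_upwards [Icc_mem_nhdsGE hε] with r hr
    exact hcan r (hord.out h0J hεJ hr) hr.1
  exact (uniqueDiffOn_Ici (0 : ℝ) 0 self_mem_Ici).eq_deriv _ hlie.hasDerivWithinAt hzero

variable {p : ℕ} {Ω : ∀ x : V, TangentSpace 𝓘(ℝ, E) x [⋀^Fin p]→L[ℝ] ℝ}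

theorem exists_pullback_frame (hφ : IsSmoothFlow ξ φ) (hΩ : IsWedgeOfMu g φ Ω) (x : V) (s : ℝ) :
    ∃ k : Fin p → TangentSpace 𝓘(ℝ, E) x, LinearIndependent ℝ k ∧
      (∀ i, (⟨φ s x, push (φ s) x (k i)⟩ : TangentBundle 𝓘(ℝ, E) V) ∈ muSet g φ) ∧
      (∀ v, (⟨φ s x, push (φ s) x v⟩ : TangentBundle 𝓘(ℝ, E) V) ∈ muSet g φ →
        v ∈ Submodule.span ℝ (range k)) ∧
      ∀ w : Fin p → TangentSpace 𝓘(ℝ, E) x, (Ω (φ s x) fun j ↦ push (φ s) x (w j)) =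
        (Matrix.of fun i j ↦ g.pullback φ x s (k i) (w j)).det := by
  obtain ⟨K, hKmu, hKli, hKspan, hKdet⟩ := hΩ (φ s x)
  choose k hk using fun i ↦ (hφ.push_bijective s x).2 (K i)
  obtain rfl : (push (φ s) x).toLinearMap ∘ k = K := funext hk
  refine ⟨k, hKli.of_comp _, hKmu, fun v hv ↦ ?_, fun w ↦ hKdet _⟩
  have hspan := hKspan _ hv
  rw [range_comp, Submodule.span_image] at hspan
  obtain ⟨v', hv', heq⟩ := hspan
  rwa [← (hφ.push_bijective s x).1 heq]

theorem null_push_of_mem_muSet (hφ : IsSmoothFlow ξ φ)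
    (hnull : ∀ x k, g.form x k k = 0 → 0 ≤ lieMetric g φ x k k) (hΩ : IsWedgeOfMu g φ Ω)
    (hlie : LieProportional φ Ω) {x : V} {v : TangentSpace 𝓘(ℝ, E) x}
    (hv : (⟨x, v⟩ : TangentBundle 𝓘(ℝ, E) V) ∈ muSet g φ) {s : ℝ} (hs : 0 ≤ s) :
    g.form (φ s x) (push (φ s) x v) (push (φ s) x v) = 0 := by
  obtain ⟨B', hB, hB'⟩ := hφ.exists_isExpandingCurve_pullback hnull x
  choose k hkli hkmu hkspan hkdet using hφ.exists_pullback_frame hΩ x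
  obtain ⟨β, hβ⟩ := hlie
  have hdet (s) (w : Fin p → TangentSpace 𝓘(ℝ, E) x) :
      HasDerivAt (fun s ↦ (Matrix.of fun i j ↦ g.pullback φ x s (k s i) (w j)).det)
        (β (φ s x) * (Matrix.of fun i j ↦ g.pullback φ x s (k s i) (w j)).det) s := by
    rw [← hkdet s w, ← funext fun s ↦ hkdet s w]
    exact hφ.hasDerivAt_apply_push (F := fun y ↦ Ω y) hβ s x w
  have hθ (s) : LinearIndependent ℝ fun i ↦ (g.pullback φ x s).toBilinForm (k s i) :=
    (hkli s).map' _ (hB.isLorentzForm s).ker_eq_bot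
  have hperp (s) (u : E) : (∀ i, g.pullback φ x s (k s i) u = 0) ↔
      ∀ i, g.pullback φ x 0 (k 0 i) u = 0 :=
    forall_apply_eq_zero_iff_of_hasDerivAt_det hθ (β := fun s ↦ β (φ s x)) hdet s 0 u
  have hv' : (⟨φ 0 x, push (φ 0) x v⟩ : TangentBundle 𝓘(ℝ, E) V) ∈ muSet g φ := by
    have heq := hφ.apply_push_zero (fun y w ↦ (⟨y, w ()⟩ : TangentBundle 𝓘(ℝ, E) V)) x fun _ ↦ v
    exact heq.symm ▸ hv
  rw [← g.pullback_apply]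
  exact hB.null_of_mem_span hkli (fun s i ↦ (hkmu s i).2.1)
    (fun s i ↦ (hB' s _ _).trans (hkmu s i).2.2) hperp (hkspan 0 v hv') hv.1 hv'.2.1 hs

end IsSmoothFlow

end CausalSymmetry

end CausalSym

theorem theorem7p1_general {E : Type*} [NormedAddCommGroup E] [NormedSpace ℝ E]
    [FiniteDimensional ℝ E] {V : Type*} [TopologicalSpace V] [T2Space V] [ChartedSpace E V]
    [IsManifold 𝓘(ℝ, E) ∞ V] (g : CausalSym.LorentzMetric E V) (τ : CausalSym.TimeOrientation g)
    (ξ : ∀ x : V, TangentSpace 𝓘(ℝ, E) x)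
    (hξ : ContMDiff 𝓘(ℝ, E) 𝓘(ℝ, E).tangent ∞
      (fun x ↦ (⟨x, ξ x⟩ : TangentBundle 𝓘(ℝ, E) V)))
    (φ : ℝ → V → V) (hφ : CausalSym.IsFlow ξ φ)
    (hnull : ∀ x k, g.form x k k = 0 → 0 ≤ CausalSym.lieMetric g φ x k k) :
    CausalSym.IsCausalPreserving g τ ξ ∧ ∀ J, CausalSym.IsCausalSubmonoid g τ φ J →
      CausalSym.canonicalNullDirections g φ J ⊆ CausalSym.muSet g φ ∧
      ∀ (p : ℕ) (Ω : ∀ x : V, TangentSpace 𝓘(ℝ, E) x [⋀^Fin p]→L[ℝ] ℝ),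
        CausalSym.IsWedgeOfMu g φ Ω → CausalSym.LieProportional φ Ω →
        CausalSym.canonicalNullDirections g φ J = CausalSym.muSet g φ := by
  have hflow : CausalSym.IsSmoothFlow ξ φ := ⟨hφ, hξ⟩
  refine ⟨hflow.isCausalPreserving τ hnull, fun J hJ ↦ ?_⟩
  have hsub := hflow.canonicalNullDirections_subset hJ
  refine ⟨hsub, fun p Ω hΩ hlie ↦ hsub.antisymm fun k hk ↦ ?_⟩
  exact ⟨hk.1, hk.2.1, fun s _ hs ↦ hflow.null_push_of_mem_muSet hnull hΩ hlie hk hs⟩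

theorem theorem7p1 {E : Type*} [NormedAddCommGroup E] [NormedSpace ℝ E] [FiniteDimensional ℝ E]
    {V : Type*} [TopologicalSpace V] [T2Space V] [ChartedSpace E V]
    [IsManifold (modelWithCornersSelf ℝ E) (⊤ : ℕ∞) V]
    (g : CausalSym.LorentzMetric E V) (τ : CausalSym.TimeOrientation g)
    (ξ : ∀ x : V, TangentSpace (modelWithCornersSelf ℝ E) x)
    (_hξ : ContMDiff (modelWithCornersSelf ℝ E) (modelWithCornersSelf ℝ E).tangent (⊤ : ℕ∞)
      (fun x ↦ (⟨x, ξ x⟩ : TangentBundle (modelWithCornersSelf ℝ E) V)))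
    (φ : ℝ → V → V) (_hφ : CausalSym.IsFlow ξ φ)
    (α : V → ℝ)
    (_hfuture : ∀ x, CausalSym.IsFutureTensor g τ x
      (fun u v ↦ CausalSym.lieMetric g φ x u v - α x * g.form x u v))
    (_htype : ∀ x y, CausalSym.SameAlgebraicType g x y
      (fun u v ↦ CausalSym.lieMetric g φ x u v - α x * g.form x u v)
      (fun u v ↦ CausalSym.lieMetric g φ y u v - α y * g.form y u v)) :
    (CausalSym.muSet g φ = ∅ →
      CausalSym.IsCausalPreserving g τ ξ ∧
      ∀ J, CausalSym.IsCausalSubmonoid g τ φ J →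
        CausalSym.canonicalNullDirections g φ J = ∅) ∧
    (CausalSym.muSet g φ ≠ ∅ →
      ∀ (p : ℕ) (Ω : ∀ x : V, TangentSpace (modelWithCornersSelf ℝ E) x [⋀^Fin p]→L[ℝ] ℝ),
        CausalSym.IsWedgeOfMu g φ Ω → CausalSym.LieProportional φ Ω →
        CausalSym.IsCausalPreserving g τ ξ ∧
        ∀ J, CausalSym.IsCausalSubmonoid g τ φ J →
          CausalSym.canonicalNullDirections g φ J = CausalSym.muSet g φ) := by
  obtain ⟨hpres, hcan⟩ := theorem7p1_general g τ ξ _hξ φ _hφ fun x _ ↦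
    CausalSym.lieMetric_nonneg_of_isFutureTensor (_hfuture x)
  exact ⟨fun hμ ↦ ⟨hpres, fun J hJ ↦ Set.subset_eq_empty (hcan J hJ).1 hμ⟩,
    fun _ p Ω hΩ hlie ↦ ⟨hpres, fun J hJ ↦ (hcan J hJ).2 p Ω hΩ hlie⟩⟩
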